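/- **Definitions.** Let $d\ge 1$ and let $\mathcal G(1,d)$ be the set of one-dimensional subspaces of $\mathbb R^d$ (Euclidean norm $\|\cdot\|$). For $V,W\in\mathcal G(1,d)$ let $\angle(V,W)\in[0,\frac{\pi}{2}]$ be the angle with $\cos\angle(V,W)=\max\{v^\top w: v\in V,\ w\in W,\ \|v\|=\|w\|=1\}$. For $A\in \mathrm{GL}(\mathbb R^d)$ and $V\in\mathcal G(1,d)$ put $$a_{k+1,k+n}(V)=\sum_{j=k+1}^{k+n}\angle(A^{j-1}V,A^jV),\qquad n\in\mathbb N,\ k\in\mathbb N_0 .$$ The eight first angular values of $A$ are - (upper/lower inner) $\limsup_{n\to\infty}$, resp. $\liminf_{n\to\infty}$, of $\frac1n\sup_{V} a_{1,n}(V)$; - (upper/lower outer) $\sup_{V}\limsup_{n\to\infty}\frac1n a_{1,n}(V)$, resp. $\sup_{V}\liminf_{n\to\infty}\frac1n a_{1,n}(V)$; - (upper/lower uniform inner) $\limsup_{n\to\infty}\frac1n\sup_{V}\sup_{k\in\mathbb N_0} a_{k+1,k+n}(V)$, resp. $\liminf_{n\to\infty}\frac1n\sup_{V}\inf_{k\in\mathbb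 N_0} a_{k+1,k+n}(V)$; - (upper/lower uniform outer) $\sup_{V}\lim_{n\to\infty}\frac1n\sup_{k\in\mathbb N_0} a_{k+1,k+n}(V)$, resp. $\sup_{V}\lim_{n\to\infty}\frac1n\inf_{k\in\mathbb N_0} a_{k+1,k+n}(V)$ (these limits exist); where $V$ ranges over $\mathcal G(1,d)$. Let $\sigma(A)\subset\mathbb C$ be the set of complex eigenvalues of $A$, let $\arg$ take values in $(-\pi,\pi]$, and let $\mathrm{skew}(A)=\frac{1}{2r(A)}\|A-A^\top\|$ with the spectral norm and $r(A)=\max_{\lambda\in\sigma(A)}|\lambda|$. **Theorem.** Let $A\in \mathrm{GL}(\mathbb R^d)$ be such that every $\lambda\in\sigma(A)\setminus\mathbb R$ is algebraically simple and satisfies $|\eta|\ne|\lambda|$ for all $\eta\in\sigma(A)\setminus\{\lambda,\bar\lambda\}$ (real eigenvalues need not be simple). Then the eight first angular values of $A$ coincide; denote their common value by $\theta_1(A)$. Let $\mathbb R^d=\bigoplus_{i=1}^k \mathrm{range}(Q_i)$ be any decomposition with $Q_i\in\mathbb R^{d\times d_i}$, $d_i\ge1$, $Q_i^\top Q_i=I_{d_i}$,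 $AQ_i=Q_iA_i$, $A_i\in\mathbb R^{d_i\times d_i}$, such that for each $i$ all eigenvalues of $A_i$ have the same modulus, and these moduli are pairwise different for $i=1,\dots,k$. Then, for each of the eight types of first angular values, $$\theta_1(A)=\max_{i=1,\dots,k}\theta_1(A_i).$$ If there is $\lambda\in\mathbb R$ such that both $\lambda$ and $-\lambda$ are eigenvalues of $A$, then $\theta_1(A)=\frac{\pi}{2}$. Otherwise $$\theta_1(A)\le\max_{\lambda\in\sigma(A)}\min(|\arg\lambda|,\pi-|\arg\lambda|),$$ and in this case equality holds if the right-hand side is zero, or if, for some decomposition as above, the maximum on the right is attained at an eigenvalue $\lambda_{i_0}\in\sigma(A_{i_0})$ with $\mathrm{Im}(\lambda_{i_0})\ne0$ and $\mathrm{skew}(A_{i_0})\le1$; in the latter case $\theta_1(A)=\min(|\arg\lambda_{i_0}|,\pi-|\arg\lambda_{i_0}|)$. -/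

import Mathlib

noncomputable section

namespace AngularValues

open Filter Topology

/-- The angle `∡(V, W) ∈ [0, π/2]` of two lines (one-dimensional subspaces) of `ℝ^d`: its cosine is
the maximum of `vᵀ w` over unit vectors `v ∈ V`, `w ∈ W`. This is the (only, hence the largest)
principal angle of two subspaces of dimension one. -/
def lineAngle {d : ℕ} (V W : Submodule ℝ (EuclideanSpace ℝ (Fin d))) : ℝ :=
  Real.arccos (sSup {c : ℝ | ∃ v ∈ V, ∃ w ∈ W, ‖v‖ = 1 ∧ ‖w‖ = 1 ∧ c = inner ℝ v w})

/-- The Grassmannian `𝒢(1, d)` of one-dimensional subspaces of `ℝ^d`. -/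
abbrev Lines (d : ℕ) : Type :=
  {V : Submodule ℝ (EuclideanSpace ℝ (Fin d)) // Module.finrank ℝ V = 1}

/-- The solution operator `Φ(n, 0) = A_{n-1} ⋯ A_0` of the linear system `u_{n+1} = A_n u_n`. -/
def solOp {d : ℕ} (A : ℕ → Matrix (Fin d) (Fin d) ℝ) : ℕ → Matrix (Fin d) (Fin d) ℝ
  | 0 => 1
  | n + 1 => A n * solOp A n

/-- The image `Φ(n, 0) V` of a line under the solution operator. -/
def orbit {d : ℕ} (A : ℕ → Matrix (Fin d) (Fin d) ℝ) (V : Lines d) (n : ℕ) :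
    Submodule ℝ (EuclideanSpace ℝ (Fin d)) :=
  V.1.map (Matrix.toEuclideanLin (solOp A n))

/-- The sum `a_{k+1, k+n}(V) = ∑_{j = k+1}^{k+n} ∡(Φ(j-1, 0) V, Φ(j, 0) V)`, with `j = k + i + 1`. -/
def angleSum {d : ℕ} (A : ℕ → Matrix (Fin d) (Fin d) ℝ) (k n : ℕ) (V : Lines d) : ℝ :=
  ∑ i ∈ Finset.range n, lineAngle (orbit A V (k + i)) (orbit A V (k + i + 1))

/-- The eight types of angular values. -/
inductive AngularType : Type
  | upperInner
  | lowerInner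
  | upperOuter
  | lowerOuter
  | upperUniformInner
  | lowerUniformInner
  | upperUniformOuter
  | lowerUniformOuter

/-- The eight first angular values of an invertible system `u_{n+1} = A_n u_n` in `ℝ^d`.
For the uniform outer values the limits exist, see `tendsto_upperUniformOuter` and
`tendsto_lowerUniformOuter` below. -/
def firstAngularValue {d : ℕ} (A : ℕ → Matrix (Fin d) (Fin d) ℝ) : AngularType → ℝ
  | .upperInner => limsup (fun n : ℕ => (1 / (n : ℝ)) * ⨆ V : Lines d, angleSum A 0 n V) atTop
  | .lowerInner => liminf (fun n : ℕ => (1 / (n : ℝ)) * ⨆ V : Lines d, angleSum A 0 n V) atTop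
  | .upperOuter => ⨆ V : Lines d, limsup (fun n : ℕ => (1 / (n : ℝ)) * angleSum A 0 n V) atTop
  | .lowerOuter => ⨆ V : Lines d, liminf (fun n : ℕ => (1 / (n : ℝ)) * angleSum A 0 n V) atTop
  | .upperUniformInner =>
      limsup (fun n : ℕ => (1 / (n : ℝ)) * ⨆ V : Lines d, ⨆ k : ℕ, angleSum A k n V) atTop
  | .lowerUniformInner =>
      liminf (fun n : ℕ => (1 / (n : ℝ)) * ⨆ V : Lines d, ⨅ k : ℕ, angleSum A k n V) atTop
  | .upperUniformOuter =>
      ⨆ V : Lines d, limUnder atTop (fun n : ℕ => (1 / (n : ℝ)) * ⨆ k : ℕ, angleSum A k n V)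
  | .lowerUniformOuter =>
      ⨆ V : Lines d, limUnder atTop (fun n : ℕ => (1 / (n : ℝ)) * ⨅ k : ℕ, angleSum A k n V)

/-- The first angular values `θ_1(A)` of a single invertible matrix, i.e. of `u_{n+1} = A u_n`. -/
def theta {d : ℕ} (A : Matrix (Fin d) (Fin d) ℝ) (τ : AngularType) : ℝ :=
  firstAngularValue (fun _ => A) τ

/-- A real matrix, viewed as a complex one. -/
abbrev toComplex {d : ℕ} (A : Matrix (Fin d) (Fin d) ℝ) : Matrix (Fin d) (Fin d) ℂ :=
  A.map Complex.ofReal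

/-- The spectrum `σ(A)`: the set of all complex eigenvalues of the real matrix `A`. -/
def eigs {d : ℕ} (A : Matrix (Fin d) (Fin d) ℝ) : Set ℂ := spectrum ℂ (toComplex A)

/-- Every non-real eigenvalue `l` of `A` is (algebraically) simple, and no eigenvalue other than
`l` and its conjugate has the same modulus as `l`. -/
def SpectralCondition {d : ℕ} (A : Matrix (Fin d) (Fin d) ℝ) : Prop :=
  ∀ l ∈ eigs A, l.im ≠ 0 →
    (toComplex A).charpoly.rootMultiplicity l = 1 ∧
    ∀ m ∈ eigs A, m ≠ l → m ≠ (starRingEnd ℂ) l → ‖m‖ ≠ ‖l‖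

/-- `ℝ^d = ⨁ range (Q i)` is a decomposition into nonzero invariant subspaces of `A` that
correspond to the eigenvalues of equal modulus; the columns of each `Q i` are orthonormal and
`B i` is the matrix of `A` restricted to `range (Q i)` in this orthonormal basis. -/
structure IsModulusDecomposition {d k : ℕ} {n : Fin k → ℕ} (A : Matrix (Fin d) (Fin d) ℝ)
    (Q : (i : Fin k) → Matrix (Fin d) (Fin (n i)) ℝ)
    (B : (i : Fin k) → Matrix (Fin (n i)) (Fin (n i)) ℝ) : Prop where
  dim_pos : ∀ i, 0 < n i
  orthonormal : ∀ i, (Q i).transpose * Q i = 1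
  isInternal : DirectSum.IsInternal fun i => LinearMap.range (Q i).mulVecLin
  intertwine : ∀ i, A * Q i = Q i * B i
  equal_modulus : ∀ i, ∀ l ∈ eigs (B i), ∀ m ∈ eigs (B i), ‖l‖ = ‖m‖
  modulus_injective : Function.Injective fun i => (fun l : ℂ => ‖l‖) '' eigs (B i)

/-- The number `min(|arg l|, π - |arg l|)`. -/
def rotationAngle (l : ℂ) : ℝ := min |l.arg| (Real.pi - |l.arg|)

/-- The maximum of `min(|arg l|, π - |arg l|)` over the (finite and, for `d ≥ 1`, nonempty) set of
eigenvalues `l` of `A`. -/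
def maxRotationAngle {d : ℕ} (A : Matrix (Fin d) (Fin d) ℝ) : ℝ := sSup (rotationAngle '' eigs A)

/-- The skewness `‖A - Aᵀ‖ / (2 r(A))`, where `‖·‖` is the operator norm induced by the Euclidean
norm and `r(A)` is the maximal modulus of an eigenvalue of `A`. -/
def skew {d : ℕ} (A : Matrix (Fin d) (Fin d) ℝ) : ℝ :=
  1 / (2 * sSup ((fun l : ℂ => ‖l‖) '' eigs A)) *
    ‖Matrix.toEuclideanCLM (n := Fin d) (𝕜 := ℝ) (A - A.transpose)‖

/-! The limits in the definition of the uniform outer values exist. -/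

lemma lineAngle_nonneg {d : ℕ} (V W : Submodule ℝ (EuclideanSpace ℝ (Fin d))) :
    0 ≤ lineAngle V W := Real.arccos_nonneg _

lemma angleSum_nonneg {d : ℕ} (A : ℕ → Matrix (Fin d) (Fin d) ℝ) (k n : ℕ) (V : Lines d) :
    0 ≤ angleSum A k n V := Finset.sum_nonneg fun _ _ => lineAngle_nonneg _ _

lemma angleSum_le {d : ℕ} (A : ℕ → Matrix (Fin d) (Fin d) ℝ) (k n : ℕ) (V : Lines d) :
    angleSum A k n V ≤ n * Real.pi := by
  have h := Finset.sum_le_card_nsmul (Finset.range n)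
    (fun i => lineAngle (orbit A V (k + i)) (orbit A V (k + i + 1))) Real.pi
    (fun _ _ => Real.arccos_le_pi _)
  simpa [angleSum] using h

lemma angleSum_add {d : ℕ} (A : ℕ → Matrix (Fin d) (Fin d) ℝ) (k m n : ℕ) (V : Lines d) :
    angleSum A k (m + n) V = angleSum A k m V + angleSum A (k + m) n V := by
  simp only [angleSum, Finset.sum_range_add, add_assoc]

lemma bddAbove_angleSum {d : ℕ} (A : ℕ → Matrix (Fin d) (Fin d) ℝ) (n : ℕ) (V : Lines d) :
    BddAbove (Set.range fun k => angleSum A k n V) :=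
  ⟨n * Real.pi, by rintro _ ⟨k, rfl⟩; exact angleSum_le A k n V⟩

lemma bddBelow_angleSum {d : ℕ} (A : ℕ → Matrix (Fin d) (Fin d) ℝ) (n : ℕ) (V : Lines d) :
    BddBelow (Set.range fun k => angleSum A k n V) :=
  ⟨0, by rintro _ ⟨k, rfl⟩; exact angleSum_nonneg A k n V⟩

lemma tendsto_upperUniformOuter {d : ℕ} (A : ℕ → Matrix (Fin d) (Fin d) ℝ) (V : Lines d) :
    ∃ c, Tendsto (fun n : ℕ => (1 / (n : ℝ)) * ⨆ k : ℕ, angleSum A k n V) atTop (𝓝 c) := by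
  have hs : Subadditive fun n => ⨆ k : ℕ, angleSum A k n V := by
    intro m n
    refine ciSup_le fun k => ?_
    rw [angleSum_add]
    exact add_le_add (le_ciSup (bddAbove_angleSum A m V) k)
      (le_ciSup (bddAbove_angleSum A n V) (k + m))
  refine ⟨hs.lim, (hs.tendsto_lim ⟨0, ?_⟩).congr fun n => by ring⟩
  rintro _ ⟨n, rfl⟩
  exact div_nonneg (Real.iSup_nonneg fun k => angleSum_nonneg A k n V) (Nat.cast_nonneg n)

lemma tendsto_lowerUniformOuter {d : ℕ} (A : ℕ → Matrix (Fin d) (Fin d) ℝ) (V : Lines d) :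
    ∃ c, Tendsto (fun n : ℕ => (1 / (n : ℝ)) * ⨅ k : ℕ, angleSum A k n V) atTop (𝓝 c) := by
  have hs : Subadditive fun n => -⨅ k : ℕ, angleSum A k n V := by
    intro m n
    rw [← neg_add, neg_le_neg_iff]
    refine le_ciInf fun k => ?_
    rw [angleSum_add]
    exact add_le_add (ciInf_le (bddBelow_angleSum A m V) k)
      (ciInf_le (bddBelow_angleSum A n V) (k + m))
  refine ⟨-hs.lim, (hs.tendsto_lim ⟨-Real.pi, ?_⟩).neg.congr fun n => by ring⟩
  rintro _ ⟨n, rfl⟩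
  rcases Nat.eq_zero_or_pos n with rfl | hn
  · simpa using Real.pi_pos.le
  · have hn' : (0 : ℝ) < n := by exact_mod_cast hn
    rw [le_div_iff₀ hn']
    have h1 := ciInf_le (bddBelow_angleSum A n V) 0
    have h2 := angleSum_le A 0 n V
    linarith

end AngularValues

end

open AngularValues

/-!
For a vector `v` put `g_j(v)` for the angle between the lines of `A ^ j v` and `A ^ (j + 1) v`; all
angular values are averages of these numbers.

*Coincidence of the eight values.* Let `s_n` be the maximal sum of the first `n` angles. It is
subadditive, hence `s_n / n` converges to a number `Θ`, which bounds all eight values from above.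
By compactness of the unit sphere and a chaining argument (`exists_forall_sum_le`), there is for
each `ε > 0` a vector whose angle sums satisfy `g_0 + ⋯ + g_{n-1} ≥ n (Θ - ε)` for all `n`
at once (`exists_sum_ge`). To conclude that even the smallest of the eight values, the lower uniform
outer one, is at least `Θ`, it remains to see that averages along an orbit are uniform in
the position of the window. Expanding `v` in generalized eigenvectors shows that, after division
by `r ^ j * j.choose M`, the orbit `A ^ j v` approaches a superposition `∑ (l / r) ^ j w_l` of
eigenvectors to eigenvalues of one modulus `r`, which stays away from zero (`exists_leading_part`).
Therefore the sequence `g_j(v)` is asymptotically almost periodic, which gives the uniformity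
(`IsAsymptoticallyAlmostPeriodic.hasUniformAverage`). This part holds for all invertible matrices.

*Blocks.* The embedding of a block is isometric, so the orbits of the blocks are orbits of `A` with
the same angles. Conversely each orbit of `A` has asymptotically the angles of its component in
the block of largest modulus (`IsModulusDecomposition.exists_dominant_block`).

*Values.* The sum of unit eigenvectors to `t` and `-t` is turned by `π / 2` in each step. If there
are no such pairs, the spectral condition leaves in the superposition above only eigenvalues with
one value `φ` of `|arg|`, so that its real part runs along an ellipse with parameter speed
`φ`. The polar angle of an ellipse is its parameter plus a bounded function
(`exists_polar_angle`). Telescoping bounds the average angle by `min φ (π - φ)`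
(`sum_vecAngle_ellipse_le`), with equality if the angle between consecutive points never crosses
`π / 2` (`le_sum_vecAngle_ellipse`). For an orbit in the plane of a nonreal eigenvalue that
condition follows from the skewness being at most one (`ellipseSum_mul_sin_le`).
-/

noncomputable section

namespace AngularValues

open Filter Topology

/-! ### The angle between the lines spanned by two vectors -/

section VecAngle

variable {E F : Type*} [NormedAddCommGroup E] [InnerProductSpace ℝ E]
  [NormedAddCommGroup F] [InnerProductSpace ℝ F]

/-- The angle in `[0, π/2]` between the lines spanned by two nonzero vectors. If one of the vectors
is zero, the value is `arccos 0 = π/2`. -/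
def vecAngle (x y : E) : ℝ := Real.arccos (|inner ℝ x y| / (‖x‖ * ‖y‖))

lemma vecAngle_nonneg (x y : E) : 0 ≤ vecAngle x y := Real.arccos_nonneg _

lemma vecAngle_le_pi_div_two (x y : E) : vecAngle x y ≤ Real.pi / 2 :=
  Real.arccos_le_pi_div_two.2 (by positivity)

lemma vecAngle_le_pi (x y : E) : vecAngle x y ≤ Real.pi := Real.arccos_le_pi _

lemma vecAngle_smul_smul {s t : ℝ} (hs : s ≠ 0) (ht : t ≠ 0) (x y : E) :
    vecAngle (s • x) (t • y) = vecAngle x y := by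
  unfold vecAngle
  congr 1
  rw [real_inner_smul_left, real_inner_smul_right, norm_smul, norm_smul, abs_mul, abs_mul,
    Real.norm_eq_abs, Real.norm_eq_abs]
  have hs' := abs_pos.2 hs
  have ht' := abs_pos.2 ht
  rw [show |s| * (|t| * |inner ℝ x y|) = (|s| * |t|) * |inner ℝ x y| by ring,
    show |s| * ‖x‖ * (|t| * ‖y‖) = (|s| * |t|) * (‖x‖ * ‖y‖) by ring]
  exact mul_div_mul_left _ _ (by positivity)

lemma vecAngle_congr {x y : E} {x' y' : F} (hx : ‖x‖ = ‖x'‖) (hy : ‖y‖ = ‖y'‖)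
    (hxy : inner ℝ x y = inner ℝ x' y') : vecAngle x y = vecAngle x' y' := by
  unfold vecAngle; rw [hx, hy, hxy]

lemma continuousOn_vecAngle :
    ContinuousOn (fun p : E × E => vecAngle p.1 p.2) {p | p.1 ≠ 0 ∧ p.2 ≠ 0} := by
  refine Real.continuous_arccos.comp_continuousOn (ContinuousOn.div (by fun_prop) (by fun_prop) ?_)
  rintro ⟨x, y⟩ ⟨hx, hy⟩
  exact mul_ne_zero (norm_ne_zero_iff.2 hx) (norm_ne_zero_iff.2 hy)

/-- On pairs of vectors whose norms stay between two positive constants the angle is uniformly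
continuous. -/
lemma vecAngle_uniform [ProperSpace E] {c C : ℝ} (hc : 0 < c) {ε : ℝ} (hε : 0 < ε) :
    ∃ δ > 0, ∀ x y x' y' : E, c ≤ ‖x‖ → ‖x‖ ≤ C → c ≤ ‖y‖ → ‖y‖ ≤ C → c ≤ ‖x'‖ → ‖x'‖ ≤ C →
      c ≤ ‖y'‖ → ‖y'‖ ≤ C → ‖x - x'‖ < δ → ‖y - y'‖ < δ →
      |vecAngle x y - vecAngle x' y'| < ε := by
  let K : Set E := {x | c ≤ ‖x‖} ∩ Metric.closedBall 0 C
  have hK : IsCompact K := (isCompact_closedBall _ _).inter_left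
    (isClosed_le continuous_const continuous_norm)
  have hu : UniformContinuousOn (fun p : E × E => vecAngle p.1 p.2) (K ×ˢ K) := by
    refine (hK.prod hK).uniformContinuousOn_of_continuous (continuousOn_vecAngle.mono ?_)
    rintro ⟨x, y⟩ ⟨hx, hy⟩
    exact ⟨norm_pos_iff.1 (hc.trans_le hx.1), norm_pos_iff.1 (hc.trans_le hy.1)⟩
  obtain ⟨δ, hδ, h⟩ := Metric.uniformContinuousOn_iff.1 hu ε hε
  refine ⟨δ, hδ, fun x y x' y' h1 h2 h3 h4 h5 h6 h7 h8 h9 h10 => ?_⟩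
  have := h (x, y) ⟨⟨h1, by simpa using h2⟩, ⟨h3, by simpa using h4⟩⟩ (x', y')
    ⟨⟨h5, by simpa using h6⟩, ⟨h7, by simpa using h8⟩⟩
    (by rw [Prod.dist_eq, dist_eq_norm, dist_eq_norm]; exact max_lt h9 h10)
  simpa [Real.dist_eq] using this

/-- Two sequences that approach each other and stay in an annulus have asymptotically equal
consecutive angles. -/
lemma tendsto_vecAngle_sub [ProperSpace E] {p q : ℕ → E} {c C : ℝ} (hc : 0 < c)
    (hq : ∀ᶠ j in atTop, c ≤ ‖q j‖ ∧ ‖q j‖ ≤ C)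
    (hpq : Tendsto (fun j => p j - q j) atTop (𝓝 0)) :
    Tendsto (fun j => vecAngle (p j) (p (j + 1)) - vecAngle (q j) (q (j + 1))) atTop (𝓝 0) := by
  rw [Metric.tendsto_atTop]
  intro ε hε
  obtain ⟨δ, hδ, h⟩ := vecAngle_uniform (E := E) (C := C + c / 2) (half_pos hc) hε
  have hev : ∀ᶠ j in atTop, ‖p j - q j‖ < δ ∧ ‖p j - q j‖ < c / 2 := by
    have := tendsto_zero_iff_norm_tendsto_zero.1 hpq
    exact (this.eventually_lt_const hδ).and (this.eventually_lt_const (half_pos hc))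
  have hall : ∀ᶠ j in atTop, (c / 2 ≤ ‖p j‖ ∧ ‖p j‖ ≤ C + c / 2) ∧
      (c / 2 ≤ ‖q j‖ ∧ ‖q j‖ ≤ C + c / 2) ∧ ‖p j - q j‖ < δ := by
    filter_upwards [hq, hev] with j h1 h2
    have h3 : ‖p j‖ ≤ ‖q j‖ + ‖p j - q j‖ := norm_le_norm_add_norm_sub (q j) (p j) |>.trans
      (by rw [norm_sub_rev])
    have h4 : ‖q j‖ ≤ ‖p j‖ + ‖p j - q j‖ := norm_le_norm_add_norm_sub (p j) (q j)
    refine ⟨⟨?_, ?_⟩, ⟨?_, ?_⟩, h2.1⟩ <;> linarith [h1.1, h1.2, h2.2]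
  obtain ⟨N, hN⟩ := eventually_atTop.1 hall
  refine ⟨N, fun j hj => ?_⟩
  obtain ⟨⟨a1, a2⟩, ⟨a3, a4⟩, a5⟩ := hN j hj
  obtain ⟨⟨b1, b2⟩, ⟨b3, b4⟩, b5⟩ := hN (j + 1) (by omega)
  rw [dist_zero_right]
  exact h _ _ _ _ a1 a2 b1 b2 a3 a4 b3 b4 a5 b5

end VecAngle

/-! ### Lines and vectors -/

section Lines

variable {d : ℕ}

lemma lineAngle_span {x y : EuclideanSpace ℝ (Fin d)} (hx : x ≠ 0) (hy : y ≠ 0) :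
    lineAngle (Submodule.span ℝ {x}) (Submodule.span ℝ {y}) = vecAngle x y := by
  have hx' := norm_pos_iff.2 hx
  have hy' := norm_pos_iff.2 hy
  unfold lineAngle vecAngle
  congr 1
  refine IsGreatest.csSup_eq ⟨?_, ?_⟩
  · have h1 : ‖(‖x‖⁻¹ : ℝ) • x‖ = 1 := by rw [norm_smul]; simp [hx]
    have h2 : ‖(‖y‖⁻¹ : ℝ) • y‖ = 1 := by rw [norm_smul]; simp [hy]
    rcases le_total 0 (inner ℝ x y) with h | h
    · refine ⟨(‖x‖⁻¹ : ℝ) • x, Submodule.smul_mem _ _ (Submodule.mem_span_singleton_self x),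
        (‖y‖⁻¹ : ℝ) • y, Submodule.smul_mem _ _ (Submodule.mem_span_singleton_self y), h1, h2, ?_⟩
      rw [real_inner_smul_left, real_inner_smul_right, abs_of_nonneg h]
      field_simp
    · refine ⟨-((‖x‖⁻¹ : ℝ) • x), neg_mem (Submodule.smul_mem _ _
        (Submodule.mem_span_singleton_self x)),
        (‖y‖⁻¹ : ℝ) • y, Submodule.smul_mem _ _ (Submodule.mem_span_singleton_self y),
        by rw [norm_neg, h1], h2, ?_⟩
      rw [inner_neg_left, real_inner_smul_left, real_inner_smul_right, abs_of_nonpos h]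
      field_simp
  · rintro _ ⟨v, hv, w, hw, hv1, hw1, rfl⟩
    obtain ⟨s, rfl⟩ := Submodule.mem_span_singleton.1 hv
    obtain ⟨t, rfl⟩ := Submodule.mem_span_singleton.1 hw
    rw [norm_smul, Real.norm_eq_abs] at hv1 hw1
    rw [real_inner_smul_left, real_inner_smul_right, le_div_iff₀ (by positivity)]
    calc s * (t * inner ℝ x y) * (‖x‖ * ‖y‖) ≤ |s * (t * inner ℝ x y)| * (‖x‖ * ‖y‖) := by
          gcongr; exact le_abs_self _
      _ = (|s| * ‖x‖) * (|t| * ‖y‖) * |inner ℝ x y| := by rw [abs_mul, abs_mul]; ring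
      _ = |inner ℝ x y| := by rw [hv1, hw1]; ring

/-- The line spanned by a nonzero vector. -/
def lineOf (v : EuclideanSpace ℝ (Fin d)) (hv : v ≠ 0) : Lines d :=
  ⟨Submodule.span ℝ {v}, finrank_span_singleton hv⟩

lemma exists_lineOf (V : Lines d) : ∃ v, ∃ hv : v ≠ 0, V = lineOf v hv := by
  obtain ⟨⟨v, hvV⟩, hv, h⟩ := finrank_eq_one_iff'.1 V.2
  refine ⟨v, fun h0 => hv (Subtype.ext h0), Subtype.ext (le_antisymm ?_ ?_)⟩
  · intro w hw
    obtain ⟨c, hc⟩ := h ⟨w, hw⟩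
    exact Submodule.mem_span_singleton.2 ⟨c, congrArg Subtype.val hc⟩
  · exact (Submodule.span_singleton_le_iff_mem _ _).2 hvV

lemma nonempty_lines (hd : 0 < d) : Nonempty (Lines d) :=
  ⟨lineOf (EuclideanSpace.single ⟨0, hd⟩ 1) (by simp)⟩

/-- The vector `A ^ j v`. -/
def powVec (A : Matrix (Fin d) (Fin d) ℝ) (j : ℕ) (v : EuclideanSpace ℝ (Fin d)) :
    EuclideanSpace ℝ (Fin d) := Matrix.toEuclideanLin (A ^ j) v

lemma powVec_ofLp (A : Matrix (Fin d) (Fin d) ℝ) (j : ℕ) (v : EuclideanSpace ℝ (Fin d)) :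
    (powVec A j v).ofLp = (A ^ j).mulVec v.ofLp := rfl

lemma powVec_zero (A : Matrix (Fin d) (Fin d) ℝ) (v : EuclideanSpace ℝ (Fin d)) :
    powVec A 0 v = v := by
  apply WithLp.ofLp_injective; simp [powVec_ofLp]

lemma powVec_add (A : Matrix (Fin d) (Fin d) ℝ) (j k : ℕ) (v : EuclideanSpace ℝ (Fin d)) :
    powVec A (j + k) v = powVec A k (powVec A j v) := by
  apply WithLp.ofLp_injective
  simp [powVec_ofLp, add_comm j k, pow_add]

lemma powVec_smul (A : Matrix (Fin d) (Fin d) ℝ) (j : ℕ) (c : ℝ) (v : EuclideanSpace ℝ (Fin d)) :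
    powVec A j (c • v) = c • powVec A j v := map_smul _ _ _

lemma powVec_ne_zero {A : Matrix (Fin d) (Fin d) ℝ} (hA : IsUnit A) (j : ℕ)
    {v : EuclideanSpace ℝ (Fin d)} (hv : v ≠ 0) : powVec A j v ≠ 0 := by
  intro h
  apply hv
  have h1 : (A ^ j).mulVec v.ofLp = (A ^ j).mulVec 0 := by
    rw [← powVec_ofLp, h]; simp
  apply WithLp.ofLp_injective
  exact Matrix.mulVec_injective_of_isUnit (hA.pow j) h1

lemma continuous_powVec (A : Matrix (Fin d) (Fin d) ℝ) (j : ℕ) : Continuous (powVec A j) :=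
  LinearMap.continuous_of_finiteDimensional (Matrix.toEuclideanLin (A ^ j))

lemma solOp_const (A : Matrix (Fin d) (Fin d) ℝ) (n : ℕ) : solOp (fun _ => A) n = A ^ n := by
  induction n with
  | zero => simp [solOp]
  | succ n ih => rw [solOp, ih, pow_succ']

lemma orbit_lineOf (A : Matrix (Fin d) (Fin d) ℝ) {v : EuclideanSpace ℝ (Fin d)} (hv : v ≠ 0)
    (n : ℕ) : orbit (fun _ => A) (lineOf v hv) n = Submodule.span ℝ {powVec A n v} := by
  rw [orbit, solOp_const, lineOf, Submodule.map_span, Set.image_singleton]; rfl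

/-- The angle between the lines spanned by `A ^ j v` and `A ^ (j + 1) v`. -/
def stepAngle (A : Matrix (Fin d) (Fin d) ℝ) (v : EuclideanSpace ℝ (Fin d)) (j : ℕ) : ℝ :=
  vecAngle (powVec A j v) (powVec A (j + 1) v)

lemma stepAngle_nonneg (A : Matrix (Fin d) (Fin d) ℝ) (v : EuclideanSpace ℝ (Fin d)) (j : ℕ) :
    0 ≤ stepAngle A v j := vecAngle_nonneg _ _

lemma stepAngle_le_pi (A : Matrix (Fin d) (Fin d) ℝ) (v : EuclideanSpace ℝ (Fin d)) (j : ℕ) :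
    stepAngle A v j ≤ Real.pi := vecAngle_le_pi _ _

lemma stepAngle_powVec (A : Matrix (Fin d) (Fin d) ℝ) (v : EuclideanSpace ℝ (Fin d)) (k j : ℕ) :
    stepAngle A (powVec A k v) j = stepAngle A v (k + j) := by
  simp only [stepAngle, ← powVec_add, add_assoc]

lemma stepAngle_smul (A : Matrix (Fin d) (Fin d) ℝ) {c : ℝ} (hc : c ≠ 0)
    (v : EuclideanSpace ℝ (Fin d)) (j : ℕ) : stepAngle A (c • v) j = stepAngle A v j := by
  rw [stepAngle, powVec_smul, powVec_smul, vecAngle_smul_smul hc hc, stepAngle]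

lemma angleSum_lineOf {A : Matrix (Fin d) (Fin d) ℝ} (hA : IsUnit A)
    {v : EuclideanSpace ℝ (Fin d)} (hv : v ≠ 0) (k n : ℕ) :
    angleSum (fun _ => A) k n (lineOf v hv) = ∑ i ∈ Finset.range n, stepAngle A v (k + i) := by
  refine Finset.sum_congr rfl fun i _ => ?_
  rw [orbit_lineOf, orbit_lineOf, lineAngle_span (powVec_ne_zero hA _ hv) (powVec_ne_zero hA _ hv),
    stepAngle]

end Lines

/-! ### Almost periodic sequences have uniform averages -/

/-- A lower bound, uniform in the position of the window, for the sums over windows of length `n`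
by the sum over the initial window, up to an error that is sublinear in `n`. -/
def HasUniformAverage (y : ℕ → ℝ) : Prop :=
  ∀ ε > 0, ∀ᶠ n : ℕ in atTop, ∀ k : ℕ,
    ∑ i ∈ Finset.range n, y i - ε * n ≤ ∑ i ∈ Finset.range n, y (k + i)

/-- Bohr's condition, required only far out: `ε`-almost periods are relatively dense. -/
def IsAsymptoticallyAlmostPeriodic (y : ℕ → ℝ) : Prop :=
  ∀ ε > 0, ∃ L J : ℕ, ∀ k, ∃ p, k ≤ p ∧ p ≤ k + L ∧ ∀ j, J ≤ j → |y (j + p) - y j| ≤ ε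

lemma sum_window_shift {y : ℕ → ℝ} {C : ℝ} (h0 : ∀ j, 0 ≤ y j) (hC : ∀ j, y j ≤ C) (k l n : ℕ) :
    ∑ i ∈ Finset.range n, y (k + l + i) ≤ ∑ i ∈ Finset.range n, y (k + i) + l * C := by
  have h1 : ∑ i ∈ Finset.range (l + n), y (k + i) =
      ∑ i ∈ Finset.range l, y (k + i) + ∑ i ∈ Finset.range n, y (k + l + i) := by
    simp only [Finset.sum_range_add, add_assoc]
  have h2 : ∑ i ∈ Finset.range (n + l), y (k + i) =
      ∑ i ∈ Finset.range n, y (k + i) + ∑ i ∈ Finset.range l, y (k + n + i) := by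
    simp only [Finset.sum_range_add, add_assoc]
  have h3 : ∑ i ∈ Finset.range l, y (k + n + i) ≤ l * C := by
    simpa using Finset.sum_le_card_nsmul (Finset.range l) (fun i => y (k + n + i)) C
      (fun _ _ => hC _)
  have h4 : 0 ≤ ∑ i ∈ Finset.range l, y (k + i) := Finset.sum_nonneg fun _ _ => h0 _
  rw [add_comm n l] at h2
  linarith

lemma IsAsymptoticallyAlmostPeriodic.hasUniformAverage {y : ℕ → ℝ} {C : ℝ} (h0 : ∀ j, 0 ≤ y j)
    (hC : ∀ j, y j ≤ C) (hy : IsAsymptoticallyAlmostPeriodic y) : HasUniformAverage y := by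
  intro ε hε
  obtain ⟨L, J, hLJ⟩ := hy (ε / 2) (half_pos hε)
  have hC0 : 0 ≤ C := (h0 0).trans (hC 0)
  have hlarge : ∀ᶠ n : ℕ in atTop, (J + L) * C ≤ ε / 2 * n := by
    have : Tendsto (fun n : ℕ => ε / 2 * (n : ℝ)) atTop atTop :=
      tendsto_natCast_atTop_atTop.const_mul_atTop (half_pos hε)
    exact this.eventually_ge_atTop _
  filter_upwards [hlarge] with n hn k
  obtain ⟨p, hkp, hpL, hp⟩ := hLJ k
  obtain ⟨l, rfl⟩ := Nat.exists_eq_add_of_le hkp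
  have h1 := sum_window_shift h0 hC k l n
  have hl : (l : ℝ) * C ≤ L * C := by
    have : (l : ℝ) ≤ L := by exact_mod_cast (by omega : l ≤ L)
    gcongr
  have h2 : ∀ m : ℕ, ∑ i ∈ Finset.range m, y i - J * C - ε / 2 * m ≤
      ∑ i ∈ Finset.range m, y (k + l + i) := by
    intro m
    induction m with
    | zero => simp; positivity
    | succ m ih =>
      rw [Finset.sum_range_succ, Finset.sum_range_succ]
      rcases le_or_gt J m with hm | hm
      · have := (abs_le.1 (hp m hm)).1
        rw [add_comm m] at this
        push_cast
        linarith
      · have h3 : ∑ i ∈ Finset.range (m + 1), y i ≤ (m + 1 : ℕ) * C := by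
          simpa using Finset.sum_le_card_nsmul (Finset.range (m + 1)) y C (fun _ _ => hC _)
        rw [Finset.sum_range_succ] at h3
        have h4 : ((m + 1 : ℕ) : ℝ) * C ≤ J * C := by gcongr; exact_mod_cast hm
        have h5 : 0 ≤ ∑ i ∈ Finset.range m, y (k + l + i) := Finset.sum_nonneg fun _ _ => h0 _
        have h6 := h0 (k + l + m)
        have h7 : 0 ≤ ε / 2 * ((m + 1 : ℕ) : ℝ) := by positivity
        linarith
  have := h2 n
  linarith

/-- Sums of asymptotically equal sequences differ by a sublinear amount. -/
lemma exists_sum_le_of_tendsto_sub {y z : ℕ → ℝ}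
    (h : Tendsto (fun j => y j - z j) atTop (𝓝 0)) {ε : ℝ} (hε : 0 < ε) :
    ∃ C, ∀ n : ℕ, ∑ i ∈ Finset.range n, y i ≤ ∑ i ∈ Finset.range n, z i + ε * n + C := by
  obtain ⟨N, hN⟩ := eventually_atTop.1 (h.eventually_le_const hε)
  refine ⟨∑ i ∈ Finset.range N, |y i - z i|, fun n => ?_⟩
  have h1 : ∀ n : ℕ, ∑ i ∈ Finset.range n, (y i - z i) ≤
      ε * n + ∑ i ∈ Finset.range N, |y i - z i| := by
    intro n
    induction n with
    | zero => simp only [Finset.range_zero, Finset.sum_empty]; positivity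
    | succ n ih =>
      rcases le_or_gt N n with hn | hn
      · rw [Finset.sum_range_succ]
        have := hN n hn
        push_cast
        linarith
      · calc ∑ i ∈ Finset.range (n + 1), (y i - z i)
            ≤ ∑ i ∈ Finset.range (n + 1), |y i - z i| :=
              Finset.sum_le_sum fun _ _ => le_abs_self _
          _ ≤ ∑ i ∈ Finset.range N, |y i - z i| :=
              Finset.sum_le_sum_of_subset_of_nonneg (Finset.range_mono hn)
                fun _ _ _ => abs_nonneg _
          _ ≤ _ := le_add_of_nonneg_left (by positivity)
  have := h1 n
  rw [Finset.sum_sub_distrib] at this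
  linarith

/-! ### Maximal angle sums -/

section MaxSum

variable {d : ℕ} {A : Matrix (Fin d) (Fin d) ℝ}

/-- The maximal angle sum `sup_V a_{1,n}(V)`. -/
def maxSum (A : Matrix (Fin d) (Fin d) ℝ) (n : ℕ) : ℝ :=
  ⨆ V : Lines d, angleSum (fun _ => A) 0 n V

lemma angleSum_le_maxSum (hA : IsUnit A) (k n : ℕ) (V : Lines d) :
    angleSum (fun _ => A) k n V ≤ maxSum A n := by
  obtain ⟨v, hv, rfl⟩ := exists_lineOf V
  have h : angleSum (fun _ => A) k n (lineOf v hv) =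
      angleSum (fun _ => A) 0 n (lineOf (powVec A k v) (powVec_ne_zero hA k hv)) := by
    rw [angleSum_lineOf hA, angleSum_lineOf hA]
    simp only [stepAngle_powVec, zero_add]
  rw [h]
  refine le_ciSup (f := fun V : Lines d => angleSum (fun _ => A) 0 n V) ⟨n * Real.pi, ?_⟩ _
  rintro _ ⟨W, rfl⟩
  exact angleSum_le _ _ _ _

lemma maxSum_nonneg (n : ℕ) : 0 ≤ maxSum A n := Real.iSup_nonneg fun _ => angleSum_nonneg _ _ _ _

lemma subadditive_maxSum (hd : 0 < d) (hA : IsUnit A) : Subadditive (maxSum A) := by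
  intro m n
  have := nonempty_lines hd
  refine ciSup_le fun V => ?_
  rw [angleSum_add]
  exact add_le_add (angleSum_le_maxSum hA _ _ _) (angleSum_le_maxSum hA _ _ _)

/-- If every vector has some window whose angle sum is less than `c` times its length, then
by compactness the window lengths can be bounded, and chaining the windows bounds all angle sums. -/
lemma exists_forall_sum_le (hA : IsUnit A) {c : ℝ}
    (h : ∀ v : EuclideanSpace ℝ (Fin d), v ≠ 0 → ∃ n : ℕ,
      ∑ i ∈ Finset.range n, stepAngle A v i < n * c) :
    ∃ C, ∀ v : EuclideanSpace ℝ (Fin d), v ≠ 0 → ∀ m : ℕ,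
      ∑ i ∈ Finset.range m, stepAngle A v i ≤ m * c + C := by
  have hcont : ∀ j, ContinuousOn (fun v => stepAngle A v j) {v | v ≠ 0} := by
    intro j
    refine continuousOn_vecAngle.comp (f := fun v => (powVec A j v, powVec A (j + 1) v))
      (((continuous_powVec A j).prodMk (continuous_powVec A (j + 1))).continuousOn) ?_
    exact fun v hv => ⟨powVec_ne_zero hA _ hv, powVec_ne_zero hA _ hv⟩
  have hne : ∀ v ∈ Metric.sphere (0 : EuclideanSpace ℝ (Fin d)) 1, v ≠ 0 := by
    rintro v hv rfl; simp at hv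
  have hbound : ∃ N : ℕ, ∀ v ∈ Metric.sphere (0 : EuclideanSpace ℝ (Fin d)) 1, ∃ n : ℕ, n ≤ N ∧
      ∑ i ∈ Finset.range n, stepAngle A v i < n * c := by
    obtain ⟨N, hN⟩ := (isCompact_sphere (0 : EuclideanSpace ℝ (Fin d)) 1).elim_directed_cover
      (fun N : ℕ => ⋃ n ≤ N, {v | v ≠ 0 ∧ ∑ i ∈ Finset.range n, stepAngle A v i < n * c})
      (fun N => isOpen_biUnion fun n _ => by
        have h1 : ContinuousOn (fun v => ∑ i ∈ Finset.range n, stepAngle A v i) {v | v ≠ 0} :=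
          continuousOn_finsetSum _ fun j _ => hcont j
        exact h1.isOpen_inter_preimage isOpen_ne (isOpen_Iio (a := n * c)))
      (fun v hv => by
        obtain ⟨n, hn⟩ := h v (hne v hv)
        exact Set.mem_iUnion.2 ⟨n, Set.mem_iUnion₂.2 ⟨n, le_rfl, hne v hv, hn⟩⟩)
      (directed_of_isDirected_le fun M N hMN =>
        Set.biUnion_subset_biUnion_left fun n (hn : n ≤ M) => hn.trans hMN)
    refine ⟨N, fun v hv => ?_⟩
    obtain ⟨n, hn, _, h2⟩ := Set.mem_iUnion₂.1 (hN hv)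
    exact ⟨n, hn, h2⟩
  obtain ⟨N, hN⟩ := hbound
  have hN' : ∀ v : EuclideanSpace ℝ (Fin d), v ≠ 0 → ∃ n : ℕ, n ≤ N ∧
      ∑ i ∈ Finset.range n, stepAngle A v i < n * c := by
    intro v hv
    obtain ⟨n, hn, h2⟩ := hN ((‖v‖⁻¹ : ℝ) • v) (by simp [norm_smul, hv])
    refine ⟨n, hn, ?_⟩
    simpa only [stepAngle_smul A (inv_ne_zero (norm_ne_zero_iff.2 hv))] using h2
  refine ⟨N * Real.pi + N * |c|, fun v hv m => ?_⟩
  induction m using Nat.strong_induction_on generalizing v with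
  | _ m ih =>
    obtain ⟨n, hn, h2⟩ := hN' v hv
    have hn0 : 0 < n := by
      rcases Nat.eq_zero_or_pos n with rfl | h
      · simp at h2
      · exact h
    rcases le_or_gt n m with hnm | hnm
    · obtain ⟨l, rfl⟩ := Nat.exists_eq_add_of_le hnm
      have h3 := ih l (by omega) (powVec A n v) (powVec_ne_zero hA n hv)
      simp only [stepAngle_powVec] at h3
      rw [Finset.sum_range_add]
      push_cast
      linarith
    · have h4 : ∑ i ∈ Finset.range m, stepAngle A v i ≤ m * Real.pi := by
        simpa using Finset.sum_le_card_nsmul (Finset.range m) (stepAngle A v) Real.pi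
          (fun _ _ => stepAngle_le_pi _ _ _)
      have h5 : (m : ℝ) ≤ N := by exact_mod_cast (by omega : m ≤ N)
      have h6 : (m : ℝ) * Real.pi ≤ N * Real.pi := by gcongr
      have h7 : -((N : ℝ) * |c|) ≤ m * c := by
        have : (m : ℝ) * -c ≤ N * |c| := by
          calc (m : ℝ) * -c ≤ m * |c| := by gcongr; exact neg_le_abs c
            _ ≤ N * |c| := by gcongr
        linarith
      linarith

/-- A bound `Θ` from below for all averaged maximal sums is nearly realized along one orbit by all
of its initial averages simultaneously. -/
lemma exists_sum_ge (hd : 0 < d) (hA : IsUnit A) {Θ : ℝ}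
    (hΘ : ∀ n : ℕ, n * Θ ≤ maxSum A n) {ε : ℝ} (hε : 0 < ε) :
    ∃ v : EuclideanSpace ℝ (Fin d), v ≠ 0 ∧
      ∀ n : ℕ, n * (Θ - ε) ≤ ∑ i ∈ Finset.range n, stepAngle A v i := by
  by_contra hcon
  push Not at hcon
  obtain ⟨C, hC⟩ := exists_forall_sum_le hA hcon
  have := nonempty_lines hd
  have h1 : ∀ n : ℕ, (n : ℝ) * ε ≤ C := by
    intro n
    have h2 : maxSum A n ≤ n * (Θ - ε) + C := by
      refine ciSup_le fun V => ?_
      obtain ⟨v, hv, rfl⟩ := exists_lineOf V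
      rw [angleSum_lineOf hA]
      simpa only [zero_add] using hC v hv n
    have := hΘ n
    linarith
  obtain ⟨n, hn⟩ := exists_nat_gt (C / ε)
  rw [div_lt_iff₀ hε] at hn
  linarith [h1 n]

/-! ### Comparison of the eight angular values -/

lemma limsup_le_of_tendsto {u v : ℕ → ℝ} {a : ℝ} (h0 : ∀ n, 0 ≤ u n) (huv : ∀ n, u n ≤ v n)
    (hv : Tendsto v atTop (𝓝 a)) : limsup u atTop ≤ a := by
  rw [← hv.limsup_eq]
  exact limsup_le_limsup (Eventually.of_forall huv)
    (IsCoboundedUnder.of_frequently_ge (a := 0) (Frequently.of_forall h0)) hv.isBoundedUnder_le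

lemma liminf_le_of_tendsto {u v : ℕ → ℝ} {a : ℝ} (h0 : ∀ n, 0 ≤ u n) (huv : ∀ n, u n ≤ v n)
    (hv : Tendsto v atTop (𝓝 a)) : liminf u atTop ≤ a := by
  rw [← hv.liminf_eq]
  exact liminf_le_liminf (Eventually.of_forall huv)
    (isBoundedUnder_of ⟨0, h0⟩) hv.isCoboundedUnder_ge

lemma le_liminf_of_tendsto {u v : ℕ → ℝ} {a c : ℝ} (huv : ∀ n, u n ≤ v n)
    (hv : Tendsto v atTop (𝓝 a)) (hc : ∀ᶠ n in atTop, c ≤ u n) : c ≤ liminf u atTop :=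
  le_liminf_of_le (hv.isBoundedUnder_le.mono_le (Eventually.of_forall huv)).isCoboundedUnder_ge hc

lemma le_limsup_of_tendsto {u v : ℕ → ℝ} {a c : ℝ} (huv : ∀ n, u n ≤ v n)
    (hv : Tendsto v atTop (𝓝 a)) (hc : ∀ᶠ n in atTop, c ≤ u n) : c ≤ limsup u atTop :=
  le_limsup_of_frequently_le hc.frequently
    (hv.isBoundedUnder_le.mono_le (Eventually.of_forall huv))

/-- If the angles along each orbit have uniform averages, all eight angular values agree with the
limit of the averaged maximal angle sums. The common value dominates the average angle along each
orbit, and it is approximated from below by the averages along suitable orbits. -/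
theorem exists_common_value (hd : 0 < d) (hA : IsUnit A)
    (hav : ∀ v : EuclideanSpace ℝ (Fin d), v ≠ 0 → HasUniformAverage (stepAngle A v)) :
    ∃ Θ : ℝ, (∀ τ, theta A τ = Θ) ∧
      (∀ v : EuclideanSpace ℝ (Fin d), v ≠ 0 → ∀ c C : ℝ,
        (∀ n : ℕ, n * c ≤ ∑ i ∈ Finset.range n, stepAngle A v i + C) → c ≤ Θ) ∧
      (∀ ε > 0, ∃ v : EuclideanSpace ℝ (Fin d), v ≠ 0 ∧
        ∀ n : ℕ, n * (Θ - ε) ≤ ∑ i ∈ Finset.range n, stepAngle A v i) := by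
  have := nonempty_lines hd
  have hsub := subadditive_maxSum hd hA
  have hbdd : BddBelow (Set.range fun n => maxSum A n / n) := by
    refine ⟨0, ?_⟩
    rintro _ ⟨n, rfl⟩
    exact div_nonneg (maxSum_nonneg n) (Nat.cast_nonneg n)
  set Θ := hsub.lim with hΘdef
  have hΘ : ∀ n : ℕ, n * Θ ≤ maxSum A n := by
    intro n
    rcases Nat.eq_zero_or_pos n with rfl | hn
    · simpa using maxSum_nonneg 0
    · have := hsub.lim_le_div hbdd hn.ne'
      rw [le_div_iff₀ (by exact_mod_cast hn)] at this
      rw [mul_comm]; exact this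
  have hlim : Tendsto (fun n : ℕ => (1 / (n : ℝ)) * maxSum A n) atTop (𝓝 Θ) :=
    (hsub.tendsto_lim hbdd).congr fun n => by ring
  have hinv : ∀ n : ℕ, (0 : ℝ) ≤ 1 / n := fun n => by positivity
  have happrox : ∀ ε > 0, ∃ v : EuclideanSpace ℝ (Fin d), v ≠ 0 ∧
      ∀ n : ℕ, n * (Θ - ε) ≤ ∑ i ∈ Finset.range n, stepAngle A v i :=
    fun ε hε => exists_sum_ge hd hA hΘ hε
  -- the three averages attached to a line, in increasing order
  have bddk : ∀ n (V : Lines d), BddAbove (Set.range fun k => angleSum (fun _ => A) k n V) :=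
    fun n V => bddAbove_angleSum _ n V
  have hinf : ∀ n (V : Lines d), (⨅ k, angleSum (fun _ => A) k n V) ≤ angleSum (fun _ => A) 0 n V :=
    fun n V => ciInf_le (bddBelow_angleSum _ n V) 0
  have hsup : ∀ n (V : Lines d), angleSum (fun _ => A) 0 n V ≤ ⨆ k, angleSum (fun _ => A) k n V :=
    fun n V => le_ciSup (bddk n V) 0
  have hsup' : ∀ n (V : Lines d), (⨆ k, angleSum (fun _ => A) k n V) ≤ maxSum A n :=
    fun n V => ciSup_le fun k => angleSum_le_maxSum hA k n V
  have hinf0 : ∀ n (V : Lines d), 0 ≤ ⨅ k, angleSum (fun _ => A) k n V :=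
    fun n V => Real.iInf_nonneg fun k => angleSum_nonneg _ _ _ _
  have hsup0 : ∀ n (V : Lines d), 0 ≤ ⨆ k, angleSum (fun _ => A) k n V :=
    fun n V => Real.iSup_nonneg fun k => angleSum_nonneg _ _ _ _
  have hspecial : ∀ ε > 0, ∃ V : Lines d, ∀ᶠ n : ℕ in atTop,
      Θ - ε ≤ (1 / (n : ℝ)) * ⨅ k, angleSum (fun _ => A) k n V := by
    intro ε hε
    obtain ⟨v, hv, hvn⟩ := happrox (ε / 2) (half_pos hε)
    refine ⟨lineOf v hv, ?_⟩
    filter_upwards [hav v hv (ε / 2) (half_pos hε), eventually_gt_atTop 0] with n hn hn0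
    have hn0' : (0 : ℝ) < n := by exact_mod_cast hn0
    rw [one_div, ← div_eq_inv_mul, le_div_iff₀ hn0']
    refine le_ciInf fun k => ?_
    rw [angleSum_lineOf hA]
    have := hn k
    have := hvn n
    linarith
  -- limits of the averages along a line are at most the limit of the maximal averages
  have hUO : ∀ V : Lines d, limUnder atTop
      (fun n : ℕ => (1 / (n : ℝ)) * ⨆ k : ℕ, angleSum (fun _ => A) k n V) ≤ Θ := by
    intro V
    obtain ⟨c, hc⟩ := tendsto_upperUniformOuter (fun _ => A) V
    rw [hc.limUnder_eq]
    exact le_of_tendsto_of_tendsto' hc hlim fun n => by gcongr; exact hsup' n V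
  have hLO : ∀ V : Lines d, limUnder atTop
      (fun n : ℕ => (1 / (n : ℝ)) * ⨅ k : ℕ, angleSum (fun _ => A) k n V) ≤ Θ := by
    intro V
    obtain ⟨c, hc⟩ := tendsto_lowerUniformOuter (fun _ => A) V
    rw [hc.limUnder_eq]
    exact le_of_tendsto_of_tendsto' hc hlim fun n => by
      gcongr; exact ((hinf n V).trans (hsup n V)).trans (hsup' n V)
  have hlsup : ∀ V : Lines d, limsup
      (fun n : ℕ => (1 / (n : ℝ)) * angleSum (fun _ => A) 0 n V) atTop ≤ Θ := fun V =>
    limsup_le_of_tendsto (fun n => mul_nonneg (hinv n) (angleSum_nonneg _ _ _ _))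
      (fun n => by gcongr; exact angleSum_le_maxSum hA 0 n V) hlim
  have hlinf : ∀ V : Lines d, liminf
      (fun n : ℕ => (1 / (n : ℝ)) * angleSum (fun _ => A) 0 n V) atTop ≤ Θ := fun V =>
    liminf_le_of_tendsto (fun n => mul_nonneg (hinv n) (angleSum_nonneg _ _ _ _))
      (fun n => by gcongr; exact angleSum_le_maxSum hA 0 n V) hlim
  have hbd : ∀ f : Lines d → ℝ, (∀ V, f V ≤ Θ) → BddAbove (Set.range f) := by
    rintro f hf
    exact ⟨Θ, by rintro _ ⟨V, rfl⟩; exact hf V⟩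
  have hall : ∀ τ, theta A τ = Θ := by
    intro τ
    cases τ with
    | upperInner => exact hlim.limsup_eq
    | lowerInner => exact hlim.liminf_eq
    | upperOuter =>
      refine le_antisymm (ciSup_le hlsup) (le_of_forall_pos_sub_le fun ε hε => ?_)
      obtain ⟨V, hV⟩ := hspecial ε hε
      refine le_trans ?_ (le_ciSup (hbd _ hlsup) V)
      refine le_limsup_of_tendsto (fun n => ?_) hlim (hV.mono fun n hn => hn.trans ?_)
      · gcongr; exact angleSum_le_maxSum hA 0 n V
      · gcongr; exact hinf n V
    | lowerOuter =>
      refine le_antisymm (ciSup_le hlinf) (le_of_forall_pos_sub_le fun ε hε => ?_)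
      obtain ⟨V, hV⟩ := hspecial ε hε
      refine le_trans ?_ (le_ciSup (hbd _ hlinf) V)
      refine le_liminf_of_tendsto (fun n => ?_) hlim (hV.mono fun n hn => hn.trans ?_)
      · gcongr; exact angleSum_le_maxSum hA 0 n V
      · gcongr; exact hinf n V
    | upperUniformInner =>
      have : ∀ n : ℕ, (⨆ V : Lines d, ⨆ k : ℕ, angleSum (fun _ => A) k n V) = maxSum A n := by
        intro n
        refine le_antisymm (ciSup_le fun V => hsup' n V) (ciSup_le fun V => (hsup n V).trans ?_)
        refine le_ciSup (f := fun V : Lines d => ⨆ k : ℕ, angleSum (fun _ => A) k n V)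
          ⟨maxSum A n, ?_⟩ V
        rintro _ ⟨W, rfl⟩
        exact hsup' n W
      simp only [theta, firstAngularValue, this]
      exact hlim.limsup_eq
    | lowerUniformInner =>
      have hle : ∀ n : ℕ, (⨆ V : Lines d, ⨅ k : ℕ, angleSum (fun _ => A) k n V) ≤ maxSum A n :=
        fun n => ciSup_le fun V => (hinf n V).trans (angleSum_le_maxSum hA 0 n V)
      refine le_antisymm (liminf_le_of_tendsto
        (fun n => mul_nonneg (hinv n) (Real.iSup_nonneg fun V => hinf0 n V))
        (fun n => by gcongr; exact hle n) hlim) (le_of_forall_pos_sub_le fun ε hε => ?_)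
      obtain ⟨V, hV⟩ := hspecial ε hε
      refine le_liminf_of_tendsto (fun n => ?_) hlim (hV.mono fun n hn => hn.trans ?_)
      · gcongr; exact hle n
      · gcongr
        refine le_ciSup (f := fun V : Lines d => ⨅ k : ℕ, angleSum (fun _ => A) k n V)
          ⟨maxSum A n, ?_⟩ V
        rintro _ ⟨W, rfl⟩
        exact (hinf n W).trans (angleSum_le_maxSum hA 0 n W)
    | upperUniformOuter =>
      refine le_antisymm (ciSup_le hUO) (le_of_forall_pos_sub_le fun ε hε => ?_)
      obtain ⟨V, hV⟩ := hspecial ε hε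
      refine le_trans ?_ (le_ciSup (hbd _ hUO) V)
      obtain ⟨c, hc⟩ := tendsto_upperUniformOuter (fun _ => A) V
      rw [hc.limUnder_eq]
      exact ge_of_tendsto hc (hV.mono fun n hn => hn.trans (by
        gcongr; exact (hinf n V).trans (hsup n V)))
    | lowerUniformOuter =>
      refine le_antisymm (ciSup_le hLO) (le_of_forall_pos_sub_le fun ε hε => ?_)
      obtain ⟨V, hV⟩ := hspecial ε hε
      refine le_trans ?_ (le_ciSup (hbd _ hLO) V)
      obtain ⟨c, hc⟩ := tendsto_lowerUniformOuter (fun _ => A) V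
      rw [hc.limUnder_eq]
      exact ge_of_tendsto hc hV
  refine ⟨Θ, hall, fun v hv c C h => ?_, happrox⟩
  have h1 : ∀ᶠ n : ℕ in atTop, c ≤ (1 / (n : ℝ)) * maxSum A n + C * (1 / (n : ℝ)) := by
    filter_upwards [eventually_gt_atTop 0] with n hn
    have hn0 : (0 : ℝ) < n := by exact_mod_cast hn
    have h2 := angleSum_le_maxSum hA 0 n (lineOf v hv)
    rw [angleSum_lineOf hA] at h2
    simp only [zero_add] at h2
    have h3 := h n
    rw [show (1 / (n : ℝ)) * maxSum A n + C * (1 / (n : ℝ)) = (maxSum A n + C) / n by ring,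
      le_div_iff₀ hn0]
    linarith
  have h2 : Tendsto (fun n : ℕ => (1 / (n : ℝ)) * maxSum A n + C * (1 / (n : ℝ))) atTop
      (𝓝 (Θ + C * 0)) := hlim.add (tendsto_one_div_atTop_nhds_zero_nat.const_mul C)
  simpa using ge_of_tendsto h2 h1

end MaxSum

/-! ### The leading part of the powers of a complex endomorphism -/

/-- The growth rate of the powers of an endomorphism along a vector whose leading part belongs to
eigenvalues of modulus `r` and to height `M` in Jordan chains. -/
def growthScale (r : ℝ) (M j : ℕ) : ℝ := r ^ j * (j.choose M : ℝ)

lemma growthScale_pos {r : ℝ} (hr : 0 < r) {M j : ℕ} (hj : M ≤ j) : 0 < growthScale r M j :=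
  mul_pos (pow_pos hr j) (by exact_mod_cast Nat.choose_pos hj)

lemma tendsto_choose_mul_pow_div {ρ : ℝ} (h0 : 0 ≤ ρ) (h1 : ρ < 1) (m M : ℕ) :
    Tendsto (fun j : ℕ => (j.choose m : ℝ) * ρ ^ j / (j.choose M : ℝ)) atTop (𝓝 0) := by
  have h := tendsto_pow_const_mul_const_pow_of_abs_lt_one m
    (show |ρ| < 1 by rwa [abs_of_nonneg h0])
  refine squeeze_zero' (Eventually.of_forall fun j => by positivity) ?_ h
  filter_upwards [eventually_ge_atTop M] with j hj
  have h2 : (1 : ℝ) ≤ j.choose M := by exact_mod_cast Nat.choose_pos hj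
  have h3 : (j.choose m : ℝ) ≤ (j : ℝ) ^ m := by exact_mod_cast Nat.choose_le_pow j m
  calc (j.choose m : ℝ) * ρ ^ j / (j.choose M : ℝ) ≤ (j.choose m : ℝ) * ρ ^ j :=
        div_le_self (by positivity) h2
    _ ≤ _ := by gcongr

lemma tendsto_choose_div_choose {m M : ℕ} (h : m < M) :
    Tendsto (fun j : ℕ => (j.choose m : ℝ) / (j.choose M : ℝ)) atTop (𝓝 0) := by
  have h1 : (fun j : ℕ => (j : ℝ) ^ m) =o[atTop] fun j : ℕ => (j : ℝ) ^ M :=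
    (Asymptotics.isLittleO_pow_pow_atTop_of_lt h).comp_tendsto tendsto_natCast_atTop_atTop
  exact ((isTheta_choose m).trans_isLittleO (h1.trans_isTheta (isTheta_choose M).symm)
    ).tendsto_div_nhds_zero

lemma tendsto_growthScale_div {r r' : ℝ} (h0 : 0 < r') (h1 : r' < r) (M M' : ℕ) :
    Tendsto (fun j => growthScale r' M' j / growthScale r M j) atTop (𝓝 0) := by
  have hr : 0 < r := h0.trans h1
  refine (tendsto_choose_mul_pow_div (div_nonneg h0.le hr.le) ((div_lt_one hr).2 h1) M' M).congr
    fun j => ?_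
  rw [growthScale, growthScale, div_pow]
  field_simp

section Endomorphism

variable {V : Type*} [NormedAddCommGroup V] [NormedSpace ℂ V]

/-- Newton's binomial expansion of `f ^ j` on a generalized eigenvector. -/
lemma pow_apply_of_genEigenvector {f : Module.End ℂ V} {μ : ℂ} (hμ : μ ≠ 0) {K : ℕ} {v : V}
    (hv : ((f - μ • 1) ^ K) v = 0) (j : ℕ) :
    (f ^ j) v = ∑ m ∈ Finset.range K,
      ((j.choose m : ℂ) * μ ^ j) • ((μ ^ m)⁻¹ • ((f - μ • 1) ^ m) v) := by
  have hc : Commute (f - μ • 1) (μ • (1 : Module.End ℂ V)) :=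
    (Commute.one_right (f - μ • 1)).smul_right μ
  have h1 : (f ^ j) v = ∑ m ∈ Finset.range (j + 1),
      ((j.choose m : ℂ) * μ ^ j) • ((μ ^ m)⁻¹ • ((f - μ • 1) ^ m) v) := by
    have h2 : f ^ j = ((f - μ • 1) + μ • 1) ^ j := by rw [sub_add_cancel]
    rw [h2, hc.add_pow, LinearMap.sum_apply]
    refine Finset.sum_congr rfl fun m hm => ?_
    have hm' : m ≤ j := Nat.lt_succ_iff.1 (Finset.mem_range.1 hm)
    have h3 : (f - μ • 1) ^ m * (μ • (1 : Module.End ℂ V)) ^ (j - m) * (j.choose m : Module.End ℂ V)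
        = ((j.choose m : ℂ) * μ ^ (j - m)) • (f - μ • 1) ^ m := by
      rw [smul_pow, one_pow, mul_smul_comm, mul_one, ← nsmul_eq_mul', ← Nat.cast_smul_eq_nsmul ℂ,
        smul_smul]
    rw [h3, LinearMap.smul_apply, smul_smul]
    congr 1
    rw [mul_assoc, ← pow_sub₀ μ hμ hm']
  rw [h1]
  have h4 : ∀ N, N ≤ j + 1 + K → (∀ m, N ≤ m → m < j + 1 + K →
      ((j.choose m : ℂ) * μ ^ j) • ((μ ^ m)⁻¹ • ((f - μ • 1) ^ m) v) = 0) →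
      ∑ m ∈ Finset.range N, ((j.choose m : ℂ) * μ ^ j) • ((μ ^ m)⁻¹ • ((f - μ • 1) ^ m) v) =
      ∑ m ∈ Finset.range (j + 1 + K),
        ((j.choose m : ℂ) * μ ^ j) • ((μ ^ m)⁻¹ • ((f - μ • 1) ^ m) v) := by
    intro N hN h
    refine Finset.sum_subset (Finset.range_mono hN) fun m hm hm' => h m ?_ (Finset.mem_range.1 hm)
    simpa using hm'
  rw [h4 (j + 1) (by omega) fun m hm _ => by rw [Nat.choose_eq_zero_of_lt (by omega)]; simp,
    h4 K (by omega) fun m hm _ => by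
      obtain ⟨l, rfl⟩ := Nat.exists_eq_add_of_le' hm
      rw [pow_add (f - μ • 1) l K, Module.End.mul_apply, hv]; simp]

/-- The leading part of the orbit `f ^ j v` is a superposition of rotating eigenvectors whose
eigenvalues have one common modulus. -/
theorem exists_leading_part [FiniteDimensional ℂ V] {f : Module.End ℂ V}
    (hf : Function.Injective f) {v : V} (hv : v ≠ 0) :
    ∃ (r : ℝ) (M : ℕ) (S : Finset ℂ) (w : ℂ → V), 0 < r ∧ S.Nonempty ∧
      (∀ l ∈ S, ‖l‖ = r ∧ f.HasEigenvector l (w l)) ∧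
      Tendsto (fun j => ((growthScale r M j)⁻¹ : ℂ) • (f ^ j) v - ∑ l ∈ S, (l / r) ^ j • w l)
        atTop (𝓝 0) := by
  classical
  obtain ⟨g, hg, hgv⟩ := (Submodule.mem_iSup_iff_exists_finsupp _ v).1
    ((Module.End.iSup_maxGenEigenspace_eq_top f).symm ▸ Submodule.mem_top : v ∈ _)
  -- a common exponent annihilating all generalized eigenvectors
  obtain ⟨K, hK⟩ : ∃ K : ℕ, ∀ l : ℂ, ((f - l • 1) ^ K) (g l) = 0 := by
    choose k hk using fun l => (Module.End.mem_maxGenEigenspace f l (g l)).1 (hg l)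
    refine ⟨g.support.sup k, fun l => ?_⟩
    by_cases hl : l ∈ g.support
    · obtain ⟨n, hn⟩ := Nat.exists_eq_add_of_le' (Finset.le_sup (f := k) hl)
      rw [hn, pow_add, Module.End.mul_apply, hk, map_zero]
    · rw [Finsupp.notMem_support_iff.1 hl, map_zero]
  have hl0 : ∀ l ∈ g.support, l ≠ 0 := by
    rintro l hl rfl
    have h := hK 0
    rw [zero_smul, sub_zero] at h
    refine Finsupp.mem_support_iff.1 hl ?_
    have hinj : Function.Injective (f ^ K) := by
      rw [Module.End.coe_pow]; exact hf.iterate K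
    exact hinj (h.trans (map_zero _).symm)
  have hsne : g.support.Nonempty := by
    rw [Finsupp.support_nonempty_iff]
    rintro rfl
    exact hv (by rw [← hgv]; simp)
  obtain ⟨l₀, hl₀, hmax⟩ := Finset.exists_max_image g.support (fun l => ‖l‖) hsne
  set r := ‖l₀‖ with hr
  have hrpos : 0 < r := norm_pos_iff.2 (hl0 l₀ hl₀)
  -- the maximal height among the eigenvalues of maximal modulus
  let P : ℕ → Prop := fun m => ∃ l ∈ g.support, ‖l‖ = r ∧ ((f - l • 1) ^ m) (g l) ≠ 0
  have hPK : ∀ m, P m → m < K := by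
    rintro m ⟨l, -, -, h⟩
    by_contra hm
    obtain ⟨n, rfl⟩ := Nat.exists_eq_add_of_le' (not_lt.1 hm)
    exact h (by rw [pow_add, Module.End.mul_apply, hK, map_zero])
  have hP0 : P 0 := ⟨l₀, hl₀, rfl, by simpa using hl₀⟩
  obtain ⟨M, hM, hMmax⟩ := Finset.exists_max_image ((Finset.range K).filter P) id
    ⟨0, Finset.mem_filter.2 ⟨Finset.mem_range.2 (hPK 0 hP0), hP0⟩⟩
  have hMP : P M := (Finset.mem_filter.1 hM).2
  have hMmax' : ∀ m, P m → m ≤ M := fun m hm =>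
    hMmax m (Finset.mem_filter.2 ⟨Finset.mem_range.2 (hPK m hm), hm⟩)
  let x : ℂ → ℕ → V := fun l m => (l ^ m)⁻¹ • ((f - l • 1) ^ m) (g l)
  let S : Finset ℂ := g.support.filter fun l => ‖l‖ = r ∧ ((f - l • 1) ^ M) (g l) ≠ 0
  have hS : ∀ l, l ∈ S ↔ l ∈ g.support ∧ ‖l‖ = r ∧ ((f - l • 1) ^ M) (g l) ≠ 0 := fun l => by
    simp only [S, Finset.mem_filter]
  refine ⟨r, M, S, fun l => x l M, hrpos, ?_, ?_, ?_⟩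
  · obtain ⟨l, h1, h2⟩ := hMP
    exact ⟨l, (hS l).2 ⟨h1, h2⟩⟩
  · intro l hl
    obtain ⟨h1, h2, h3⟩ := (hS l).1 hl
    refine ⟨h2, Module.End.mem_eigenspace_iff.2 ?_, ?_⟩
    · have h4 : ((f - l • 1) ^ (M + 1)) (g l) = 0 := by
        by_contra h5
        exact absurd (hMmax' (M + 1) ⟨l, h1, h2, h5⟩) (by omega)
      rw [pow_succ', Module.End.mul_apply, LinearMap.sub_apply, LinearMap.smul_apply,
        Module.End.one_apply, sub_eq_zero] at h4
      simp only [x, map_smul]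
      rw [h4, smul_comm]
    · exact smul_ne_zero (inv_ne_zero (pow_ne_zero _ (hl0 l h1))) h3
  · have hexp : ∀ j, ((growthScale r M j)⁻¹ : ℂ) • (f ^ j) v - ∑ l ∈ S, (l / r) ^ j • x l M =
        ∑ l ∈ g.support, ∑ m ∈ Finset.range K,
          (((growthScale r M j)⁻¹ : ℂ) * ((j.choose m : ℂ) * l ^ j) -
            if l ∈ S ∧ m = M then (l / r) ^ j else 0) • x l m := by
      intro j
      simp only [sub_smul, Finset.sum_sub_distrib]
      congr 1
      · rw [← hgv, Finsupp.sum, map_sum, Finset.smul_sum]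
        refine Finset.sum_congr rfl fun l hl => ?_
        rw [pow_apply_of_genEigenvector (hl0 l hl) (hK l), Finset.smul_sum]
        exact Finset.sum_congr rfl fun m _ => smul_smul _ _ _
      · rw [← Finset.sum_subset (Finset.filter_subset _ _ : S ⊆ g.support)]
        · refine Finset.sum_congr rfl fun l hl => ?_
          rw [Finset.sum_eq_single_of_mem M (Finset.mem_range.2 (hPK M hMP))]
          · rw [if_pos ⟨hl, rfl⟩]
          · intro m _ hm
            rw [if_neg (fun h => hm h.2), zero_smul]
        · intro l _ hl
          exact Finset.sum_eq_zero fun m _ => by rw [if_neg (fun h => hl h.1), zero_smul]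
    simp only [hexp]
    have hzero : ∀ l ∈ g.support, ∀ m ∈ Finset.range K, Tendsto (fun j =>
        (((growthScale r M j)⁻¹ : ℂ) * ((j.choose m : ℂ) * l ^ j) -
            if l ∈ S ∧ m = M then (l / r) ^ j else 0) • x l m) atTop (𝓝 0) := by
      intro l hl m _
      by_cases hlm : l ∈ S ∧ m = M
      · obtain ⟨hlS, rfl⟩ := hlm
        refine tendsto_const_nhds.congr' ?_
        filter_upwards [eventually_ge_atTop m] with j hj
        have h1 : ((j.choose m : ℕ) : ℂ) ≠ 0 := by exact_mod_cast (Nat.choose_pos hj).ne'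
        have h2 : (r : ℂ) ≠ 0 := by exact_mod_cast hrpos.ne'
        rw [if_pos ⟨hlS, rfl⟩, growthScale]
        push_cast
        rw [div_pow]
        field_simp
        simp
      · simp only [if_neg hlm, sub_zero]
        by_cases hx : x l m = 0
        · simp [hx]
        rw [← zero_smul ℂ (x l m)]
        refine Tendsto.smul_const ?_ _
        rw [tendsto_zero_iff_norm_tendsto_zero]
        have hnorm : ∀ j : ℕ, ‖((growthScale r M j)⁻¹ : ℂ) * ((j.choose m : ℂ) * l ^ j)‖ =
            (j.choose m : ℝ) * (‖l‖ / r) ^ j / (j.choose M : ℝ) := by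
          intro j
          rw [norm_mul, norm_mul, norm_inv, norm_pow, Complex.norm_natCast, Complex.norm_real,
            growthScale,
            Real.norm_of_nonneg (mul_nonneg (pow_nonneg hrpos.le _) (Nat.cast_nonneg _)), div_pow]
          field_simp
        simp only [hnorm]
        rcases (hmax l hl).lt_or_eq with hlt | heq
        · exact tendsto_choose_mul_pow_div (by positivity) ((div_lt_one hrpos).2 hlt) m M
        · replace heq : ‖l‖ = r := heq
          have hPm : P m := ⟨l, hl, heq, fun h => hx (by simp only [x, h, smul_zero])⟩
          have hmM : m < M := by
            refine lt_of_le_of_ne (hMmax' m hPm) ?_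
            rintro rfl
            obtain ⟨l', -, -, h⟩ := hPm
            exact hlm ⟨(hS l).2 ⟨hl, heq, fun h => hx (by simp only [x, h, smul_zero])⟩, rfl⟩
          simp only [heq, div_self hrpos.ne', one_pow, mul_one]
          exact tendsto_choose_div_choose hmM
    simpa using tendsto_finsetSum _ fun l hl => tendsto_finsetSum _ fun m hm => hzero l hl m hm

/-- A superposition of eigenvectors to different eigenvalues with unimodular coefficients is bounded
away from zero. -/
lemma exists_le_norm_sum [FiniteDimensional ℂ V] {f : Module.End ℂ V} {S : Finset ℂ}
    (hS : S.Nonempty) {w : ℂ → V} (hw : ∀ l ∈ S, f.HasEigenvector l (w l)) :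
    ∃ c > 0, ∀ z : ℂ → ℂ, (∀ l ∈ S, ‖z l‖ = 1) → c ≤ ‖∑ l ∈ S, z l • w l‖ := by
  have hli : LinearIndependent ℂ (fun l : S => w l) :=
    Module.End.eigenvectors_linearIndependent' f (fun l : S => (l : ℂ)) Subtype.val_injective _
      fun l => hw l l.2
  obtain ⟨K, hK, hanti⟩ := LinearMap.exists_antilipschitzWith
    (Fintype.linearCombination ℂ (fun l : S => w l))
    (LinearMap.ker_eq_bot.2 (linearIndependent_iff_injective_fintypeLinearCombination.1 hli))
  refine ⟨(K : ℝ)⁻¹, by positivity, fun z hz => ?_⟩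
  obtain ⟨l, hl⟩ := hS
  have h1 := hanti.le_mul_dist (fun l : S => z l) 0
  rw [map_zero, dist_zero_right, dist_zero_right, Fintype.linearCombination_apply,
    Finset.univ_eq_attach, Finset.sum_attach S (fun l => z l • w l)] at h1
  have h2 : (1 : ℝ) ≤ ‖fun l : S => z l‖ := by
    rw [← hz l hl]; exact norm_le_pi_norm (fun l : S => z l) ⟨l, hl⟩
  rw [inv_le_iff_one_le_mul₀' (by exact_mod_cast hK)]
  exact h2.trans h1

end Endomorphism

/-- Simultaneous recurrence of finitely many rotations: the times at which all of them are close to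
the identity are relatively dense. -/
lemma exists_almost_period {S : Finset ℂ} {μ : ℂ → ℂ} (hμ : ∀ l ∈ S, ‖μ l‖ = 1) {δ : ℝ}
    (hδ : 0 < δ) : ∃ L : ℕ, ∀ k, ∃ p, k ≤ p ∧ p ≤ k + L ∧ ∀ l ∈ S, ‖μ l ^ p - 1‖ < δ := by
  let z : ℕ → (S → ℂ) := fun j l => μ l ^ j
  have hz : ∀ j (l : S), ‖z j l‖ = 1 := fun j l => by simp [z, hμ l l.2]
  have htb : TotallyBounded (Set.range z) := by
    refine (isCompact_closedBall (0 : S → ℂ) 1).totallyBounded.subset ?_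
    rintro _ ⟨j, rfl⟩
    rw [mem_closedBall_zero_iff, pi_norm_le_iff_of_nonneg zero_le_one]
    exact fun l => (hz j l).le
  obtain ⟨t, hts, htf, hcov⟩ := Metric.finite_approx_of_totallyBounded htb δ hδ
  have hq : ∀ y : t, ∃ q, z q = y := fun y => hts y.2
  choose q hq using hq
  have := htf.fintype
  refine ⟨Finset.univ.sup q, fun k => ?_⟩
  obtain ⟨y, hy, hyb⟩ := Set.mem_iUnion₂.1 (hcov ⟨k + Finset.univ.sup q, rfl⟩)
  have hle : q ⟨y, hy⟩ ≤ Finset.univ.sup q := Finset.le_sup (Finset.mem_univ _)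
  refine ⟨k + Finset.univ.sup q - q ⟨y, hy⟩, by omega, by omega, fun l hl => ?_⟩
  rw [Metric.mem_ball, show y = z (q ⟨y, hy⟩) from (hq ⟨y, hy⟩).symm, dist_eq_norm] at hyb
  have h1 := (norm_le_pi_norm _ (⟨l, hl⟩ : S)).trans_lt hyb
  have h2 : μ l ^ (k + Finset.univ.sup q) =
      μ l ^ q ⟨y, hy⟩ * μ l ^ (k + Finset.univ.sup q - q ⟨y, hy⟩) := by
    rw [← pow_add]; congr 1; omega
  simp only [Pi.sub_apply, z] at h1
  rw [h2, ← mul_sub_one, norm_mul, norm_pow, hμ l hl, one_pow, one_mul] at h1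
  exact h1

/-! ### The leading part of the powers of a real matrix -/

section RealMatrix

variable {d : ℕ}

/-- The inclusion of `ℝ^d` into `ℂ^d`. -/
def complexify : EuclideanSpace ℝ (Fin d) →ₗ[ℝ] (Fin d → ℂ) where
  toFun x i := (x i : ℂ)
  map_add' x y := by ext i; simp
  map_smul' c x := by ext i; simp

lemma complexify_apply (x : EuclideanSpace ℝ (Fin d)) (i : Fin d) :
    complexify x i = (x i : ℂ) := rfl

lemma complexify_injective : Function.Injective (complexify (d := d)) := by
  intro x y h
  ext i
  exact Complex.ofReal_injective (congrFun h i)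

lemma complexify_powVec (A : Matrix (Fin d) (Fin d) ℝ) (j : ℕ) (v : EuclideanSpace ℝ (Fin d)) :
    complexify (powVec A j v) = (Matrix.toLin' (toComplex A) ^ j) (complexify v) := by
  rw [← Matrix.toLin'_pow, Matrix.toLin'_apply]
  have h : toComplex A ^ j = toComplex (A ^ j) :=
    (map_pow (Complex.ofRealHom.mapMatrix : Matrix (Fin d) (Fin d) ℝ →+* _) A j).symm
  rw [h]
  ext i
  rw [complexify_apply, powVec_ofLp]
  simp [Matrix.mulVec, dotProduct, complexify_apply]

lemma exists_norm_complexify_bounds :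
    ∃ K > 0, (∀ x : EuclideanSpace ℝ (Fin d), ‖x‖ ≤ K * ‖complexify x‖) ∧
      ∀ x : EuclideanSpace ℝ (Fin d), ‖complexify x‖ ≤ K * ‖x‖ := by
  obtain ⟨K, hK, h⟩ := LinearMap.exists_antilipschitzWith (complexify (d := d))
    (LinearMap.ker_eq_bot.2 complexify_injective)
  let L := LinearMap.toContinuousLinearMap (complexify (d := d))
  have hK' : (0 : ℝ) < K := by exact_mod_cast hK
  refine ⟨K + ‖L‖, by positivity, fun x => ?_, fun x => ?_⟩
  · have := h.le_mul_dist x 0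
    rw [map_zero, dist_zero_right, dist_zero_right] at this
    exact this.trans (by gcongr; exact le_add_of_nonneg_right (norm_nonneg _))
  · exact (L.le_opNorm x).trans (by gcongr; exact le_add_of_nonneg_left hK'.le)

lemma mem_eigs_iff (A : Matrix (Fin d) (Fin d) ℝ) (l : ℂ) :
    l ∈ eigs A ↔ Module.End.HasEigenvalue (Matrix.toLin' (toComplex A)) l := by
  rw [eigs, Module.End.hasEigenvalue_iff_mem_spectrum, Matrix.spectrum_toLin']

lemma isUnit_toComplex {A : Matrix (Fin d) (Fin d) ℝ} (hA : IsUnit A) : IsUnit (toComplex A) :=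
  hA.map (Complex.ofRealHom.mapMatrix : Matrix (Fin d) (Fin d) ℝ →+* _)

lemma toLin'_toComplex_injective {A : Matrix (Fin d) (Fin d) ℝ} (hA : IsUnit A) :
    Function.Injective (Matrix.toLin' (toComplex A)) :=
  Matrix.mulVec_injective_of_isUnit (isUnit_toComplex hA)

/-- The leading part of the orbit of a real vector, in complex coordinates. -/
theorem exists_leading_part_real {A : Matrix (Fin d) (Fin d) ℝ} (hA : IsUnit A)
    {v : EuclideanSpace ℝ (Fin d)} (hv : v ≠ 0) :
    ∃ (r : ℝ) (M : ℕ) (S : Finset ℂ) (w : ℂ → (Fin d → ℂ)), 0 < r ∧ S.Nonempty ∧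
      (∀ l ∈ S, ‖l‖ = r ∧ l ∈ eigs A) ∧
      Tendsto (fun j => complexify ((growthScale r M j)⁻¹ • powVec A j v) -
        ∑ l ∈ S, (l / r) ^ j • w l) atTop (𝓝 0) ∧
      ∃ c > 0, ∃ C, ∀ᶠ j in atTop, c ≤ ‖(growthScale r M j)⁻¹ • powVec A j v‖ ∧
        ‖(growthScale r M j)⁻¹ • powVec A j v‖ ≤ C := by
  obtain ⟨r, M, S, w, hr, hS, hw, hlim⟩ := exists_leading_part (toLin'_toComplex_injective hA)
    (v := complexify v) (fun h => hv (complexify_injective (h.trans (map_zero _).symm)))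
  have hlim' : Tendsto (fun j => complexify ((growthScale r M j)⁻¹ • powVec A j v) -
      ∑ l ∈ S, (l / r) ^ j • w l) atTop (𝓝 0) := by
    refine hlim.congr fun j => ?_
    rw [map_smul, complexify_powVec]
    congr 1
    ext i
    simp
  refine ⟨r, M, S, w, hr, hS, fun l hl => ⟨(hw l hl).1, (mem_eigs_iff A l).2
    (Module.End.hasEigenvalue_of_hasEigenvector (hw l hl).2)⟩, hlim', ?_⟩
  obtain ⟨c, hc, hcz⟩ := exists_le_norm_sum hS fun l hl => (hw l hl).2
  obtain ⟨K, hK, hK1, hK2⟩ := exists_norm_complexify_bounds (d := d)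
  have hrot : ∀ j, ∀ l ∈ S, ‖(l / r) ^ j‖ = 1 := by
    intro j l hl
    rw [norm_pow, norm_div, (hw l hl).1, Complex.norm_real, Real.norm_of_nonneg hr.le,
      div_self hr.ne', one_pow]
  refine ⟨c / 2 / K, by positivity, K * (∑ l ∈ S, ‖w l‖ + c / 2), ?_⟩
  have hsmall := (tendsto_zero_iff_norm_tendsto_zero.1 hlim').eventually_lt_const (half_pos hc)
  filter_upwards [hsmall] with j hj
  set p := (growthScale r M j)⁻¹ • powVec A j v
  set u := ∑ l ∈ S, (l / r) ^ j • w l with hu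
  have h1 : c ≤ ‖u‖ := hcz (fun l => (l / r) ^ j) (hrot j)
  have h2 : ‖u‖ ≤ ∑ l ∈ S, ‖w l‖ := by
    refine (norm_sum_le _ _).trans (Finset.sum_le_sum fun l hl => ?_)
    rw [norm_smul, hrot j l hl, one_mul]
  have h3 : ‖complexify p‖ ≤ ‖u‖ + ‖complexify p - u‖ :=
    (norm_le_norm_add_norm_sub u _).trans (by rw [norm_sub_rev])
  have h4 : ‖u‖ ≤ ‖complexify p‖ + ‖complexify p - u‖ := norm_le_norm_add_norm_sub _ _
  refine ⟨?_, (hK1 p).trans ?_⟩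
  · rw [div_le_iff₀ hK]
    have := hK2 p
    linarith
  · gcongr; linarith

lemma stepAngle_eq_scaled (A : Matrix (Fin d) (Fin d) ℝ) (v : EuclideanSpace ℝ (Fin d)) {r : ℝ}
    (hr : 0 < r) {M j : ℕ} (hj : M ≤ j) :
    stepAngle A v j = vecAngle ((growthScale r M j)⁻¹ • powVec A j v)
      ((growthScale r M (j + 1))⁻¹ • powVec A (j + 1) v) := by
  rw [vecAngle_smul_smul (inv_ne_zero (growthScale_pos hr hj).ne')
    (inv_ne_zero (growthScale_pos hr (by omega)).ne'), stepAngle]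

/-- The angles along an orbit form an asymptotically almost periodic sequence. -/
theorem isAsymptoticallyAlmostPeriodic_stepAngle {A : Matrix (Fin d) (Fin d) ℝ} (hA : IsUnit A)
    {v : EuclideanSpace ℝ (Fin d)} (hv : v ≠ 0) :
    IsAsymptoticallyAlmostPeriodic (stepAngle A v) := by
  obtain ⟨r, M, S, w, hr, hS, hw, hlim, c, hc, C, hcC⟩ := exists_leading_part_real hA hv
  obtain ⟨K, hK, hK1, -⟩ := exists_norm_complexify_bounds (d := d)
  intro ε hε
  set p : ℕ → EuclideanSpace ℝ (Fin d) := fun j => (growthScale r M j)⁻¹ • powVec A j v with hp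
  set u : ℕ → (Fin d → ℂ) := fun j => ∑ l ∈ S, (l / r) ^ j • w l with hu
  obtain ⟨δ, hδ, hunif⟩ := vecAngle_uniform (E := EuclideanSpace ℝ (Fin d)) (C := C) hc hε
  have hη : 0 < δ / (3 * K) := by positivity
  set W := ∑ l ∈ S, ‖w l‖ with hW
  have hW0 : 0 ≤ W := Finset.sum_nonneg fun _ _ => norm_nonneg _
  have hnorm : ∀ l ∈ S, ‖l / (r : ℂ)‖ = 1 := by
    intro l hl
    rw [norm_div, (hw l hl).1, Complex.norm_real, Real.norm_of_nonneg hr.le, div_self hr.ne']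
  obtain ⟨L, hL⟩ := exists_almost_period hnorm (δ := δ / (3 * K) / (W + 1)) (by positivity)
  have hsmall := (tendsto_zero_iff_norm_tendsto_zero.1 hlim).eventually_lt_const hη
  obtain ⟨J, hJ⟩ := eventually_atTop.1 ((hsmall.and hcC).and (eventually_ge_atTop M))
  refine ⟨L, J, fun k => ?_⟩
  obtain ⟨q, hkq, hqL, hq⟩ := hL k
  have hu_close : ∀ j, ‖u (j + q) - u j‖ ≤ δ / (3 * K) := by
    intro j
    rw [hu, ← Finset.sum_sub_distrib]
    calc ‖∑ l ∈ S, ((l / (r : ℂ)) ^ (j + q) • w l - (l / (r : ℂ)) ^ j • w l)‖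
        ≤ ∑ l ∈ S, δ / (3 * K) / (W + 1) * ‖w l‖ := by
          refine (norm_sum_le _ _).trans (Finset.sum_le_sum fun l hl => ?_)
          rw [← sub_smul, norm_smul, pow_add, ← mul_sub_one, norm_mul, norm_pow, hnorm l hl,
            one_pow, one_mul]
          gcongr
          exact (hq l hl).le
      _ = δ / (3 * K) * (W / (W + 1)) := by rw [← Finset.mul_sum]; ring
      _ ≤ δ / (3 * K) * 1 := by
          gcongr
          exact (div_le_one (by positivity)).2 (by linarith)
      _ = δ / (3 * K) := mul_one _
  have hp_close : ∀ j, J ≤ j → ‖p (j + q) - p j‖ < δ := by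
    intro j hj
    have h1 := (hJ j hj).1.1
    have h2 := (hJ (j + q) (by omega)).1.1
    have h3 : complexify (p (j + q) - p j) = (complexify (p (j + q)) - u (j + q)) +
        (u (j + q) - u j) - (complexify (p j) - u j) := by rw [map_sub]; abel
    have h4 : ‖complexify (p (j + q) - p j)‖ < 3 * (δ / (3 * K)) := by
      rw [h3]
      refine (norm_sub_le _ _).trans_lt ?_
      have h5 := norm_add_le (complexify (p (j + q)) - u (j + q)) (u (j + q) - u j)
      have h6 := hu_close j
      linarith
    calc ‖p (j + q) - p j‖ ≤ K * ‖complexify (p (j + q) - p j)‖ := hK1 _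
      _ < K * (3 * (δ / (3 * K))) := by gcongr
      _ = δ := by field_simp
  refine ⟨q, hkq, hqL, fun j hj => ?_⟩
  have e1 := hJ j hj
  have e2 := hJ (j + 1) (by omega)
  have e3 := hJ (j + q) (by omega)
  have e4 := hJ (j + 1 + q) (by omega)
  have h5 := hp_close (j + 1) (by omega)
  rw [show j + 1 + q = j + q + 1 by omega] at e4 h5
  rw [stepAngle_eq_scaled A v hr e1.2, stepAngle_eq_scaled A v hr e3.2]
  exact (hunif _ _ _ _ e3.1.2.1 e3.1.2.2 e4.1.2.1 e4.1.2.2 e1.1.2.1 e1.1.2.2 e2.1.2.1 e2.1.2.2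
    (hp_close j hj) h5).le

/-- For every invertible matrix the eight angular values coincide; the common value dominates the
average angle along each orbit and is approximated by such averages. -/
theorem exists_common_value_of_isUnit {A : Matrix (Fin d) (Fin d) ℝ} (hd : 0 < d) (hA : IsUnit A) :
    ∃ Θ : ℝ, (∀ τ, theta A τ = Θ) ∧
      (∀ v : EuclideanSpace ℝ (Fin d), v ≠ 0 → ∀ c C : ℝ,
        (∀ n : ℕ, n * c ≤ ∑ i ∈ Finset.range n, stepAngle A v i + C) → c ≤ Θ) ∧
      (∀ ε > 0, ∃ v : EuclideanSpace ℝ (Fin d), v ≠ 0 ∧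
        ∀ n : ℕ, n * (Θ - ε) ≤ ∑ i ∈ Finset.range n, stepAngle A v i) :=
  exists_common_value hd hA fun _ hv =>
    (isAsymptoticallyAlmostPeriodic_stepAngle hA hv).hasUniformAverage
      (stepAngle_nonneg A _) (stepAngle_le_pi A _)

end RealMatrix

/-! ### Invariant blocks -/

section Block

variable {d m : ℕ} {A : Matrix (Fin d) (Fin d) ℝ} {Q : Matrix (Fin d) (Fin m) ℝ}
  {B : Matrix (Fin m) (Fin m) ℝ}

lemma inner_toEuclideanLin (hQ : Q.transpose * Q = 1) (x y : EuclideanSpace ℝ (Fin m)) :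
    inner ℝ (Matrix.toEuclideanLin Q x) (Matrix.toEuclideanLin Q y) = inner ℝ x y := by
  simp only [EuclideanSpace.inner_eq_star_dotProduct, star_trivial, Matrix.toLpLin_apply]
  rw [Matrix.dotProduct_mulVec, ← Matrix.mulVec_transpose, Matrix.mulVec_mulVec, hQ,
    Matrix.one_mulVec]

lemma norm_toEuclideanLin (hQ : Q.transpose * Q = 1) (x : EuclideanSpace ℝ (Fin m)) :
    ‖Matrix.toEuclideanLin Q x‖ = ‖x‖ := by
  rw [norm_eq_sqrt_real_inner, norm_eq_sqrt_real_inner, inner_toEuclideanLin hQ]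

lemma toEuclideanLin_ne_zero (hQ : Q.transpose * Q = 1) {x : EuclideanSpace ℝ (Fin m)}
    (hx : x ≠ 0) : Matrix.toEuclideanLin Q x ≠ 0 := by
  rw [← norm_pos_iff, norm_toEuclideanLin hQ]
  exact norm_pos_iff.2 hx

lemma pow_mul_intertwine (hAQ : A * Q = Q * B) (j : ℕ) : A ^ j * Q = Q * B ^ j := by
  induction j with
  | zero => simp
  | succ j ih => rw [pow_succ, Matrix.mul_assoc, hAQ, ← Matrix.mul_assoc, ih, Matrix.mul_assoc,
      ← pow_succ]

lemma powVec_toEuclideanLin (hAQ : A * Q = Q * B) (j : ℕ) (x : EuclideanSpace ℝ (Fin m)) :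
    powVec A j (Matrix.toEuclideanLin Q x) = Matrix.toEuclideanLin Q (powVec B j x) := by
  apply WithLp.ofLp_injective
  simp only [powVec_ofLp, Matrix.toLpLin_apply, Matrix.mulVec_mulVec, pow_mul_intertwine hAQ]

lemma stepAngle_toEuclideanLin (hQ : Q.transpose * Q = 1) (hAQ : A * Q = Q * B)
    (x : EuclideanSpace ℝ (Fin m)) (j : ℕ) :
    stepAngle A (Matrix.toEuclideanLin Q x) j = stepAngle B x j := by
  rw [stepAngle, stepAngle, powVec_toEuclideanLin hAQ, powVec_toEuclideanLin hAQ]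
  exact vecAngle_congr (norm_toEuclideanLin hQ _) (norm_toEuclideanLin hQ _)
    (inner_toEuclideanLin hQ _ _)

lemma isUnit_block (hA : IsUnit A) (hQ : Q.transpose * Q = 1) (hAQ : A * Q = Q * B) :
    IsUnit B := by
  rw [← Matrix.mulVec_injective_iff_isUnit]
  intro x y hxy
  have h1 : A.mulVec (Q.mulVec x) = A.mulVec (Q.mulVec y) := by
    simp only [Matrix.mulVec_mulVec, hAQ]
    rw [← Matrix.mulVec_mulVec, ← Matrix.mulVec_mulVec]
    exact congrArg _ hxy
  have h2 := congrArg (Q.transpose.mulVec) (Matrix.mulVec_injective_of_isUnit hA h1)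
  simpa [Matrix.mulVec_mulVec, hQ] using h2

end Block

namespace IsModulusDecomposition

variable {d k : ℕ} {n : Fin k → ℕ} {A : Matrix (Fin d) (Fin d) ℝ}
  {Q : (i : Fin k) → Matrix (Fin d) (Fin (n i)) ℝ}
  {B : (i : Fin k) → Matrix (Fin (n i)) (Fin (n i)) ℝ}

lemma isUnit (h : IsModulusDecomposition A Q B) (hA : IsUnit A) (i : Fin k) : IsUnit (B i) :=
  isUnit_block hA (h.orthonormal i) (h.intertwine i)

lemma exists_eq_sum (h : IsModulusDecomposition A Q B) (v : EuclideanSpace ℝ (Fin d)) :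
    ∃ x : (i : Fin k) → EuclideanSpace ℝ (Fin (n i)),
      v = ∑ i, Matrix.toEuclideanLin (Q i) (x i) := by
  obtain ⟨g, hg, hgv⟩ := (Submodule.mem_iSup_iff_exists_finsupp _ v.ofLp).1
    (h.isInternal.submodule_iSup_eq_top.symm ▸ Submodule.mem_top : v.ofLp ∈ _)
  choose x hx using hg
  refine ⟨fun i => WithLp.toLp 2 (x i), ?_⟩
  apply WithLp.ofLp_injective
  rw [← hgv, Finsupp.sum_fintype _ _ (fun _ => rfl), WithLp.ofLp_sum]
  refine Finset.sum_congr rfl fun i _ => ?_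
  rw [← hx i]; rfl

lemma eq_of_norm_eq (h : IsModulusDecomposition A Q B) {i i' : Fin k} {l l' : ℂ}
    (hl : l ∈ eigs (B i)) (hl' : l' ∈ eigs (B i')) (hll : ‖l‖ = ‖l'‖) : i = i' := by
  apply h.modulus_injective
  have key : ∀ i l, l ∈ eigs (B i) → (fun l : ℂ => ‖l‖) '' eigs (B i) = {‖l‖} := by
    intro i l hl
    refine Set.eq_singleton_iff_unique_mem.2 ⟨⟨l, hl, rfl⟩, ?_⟩
    rintro _ ⟨m, hm, rfl⟩
    exact h.equal_modulus i m hm l hl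
  simp only [key i l hl, key i' l' hl', hll]

/-- Each orbit has asymptotically the same angles as the orbit of its component in the block of
largest modulus. -/
theorem exists_dominant_block (h : IsModulusDecomposition A Q B) (hA : IsUnit A)
    {v : EuclideanSpace ℝ (Fin d)} (hv : v ≠ 0) :
    ∃ i, ∃ x : EuclideanSpace ℝ (Fin (n i)), x ≠ 0 ∧
      Tendsto (fun j => stepAngle A v j - stepAngle (B i) x j) atTop (𝓝 0) := by
  classical
  obtain ⟨x, hx⟩ := h.exists_eq_sum v
  have hlead : ∀ i, ∃ (r : ℝ) (M : ℕ) (c C : ℝ), x i ≠ 0 → 0 < r ∧ 0 < c ∧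
      (∃ l ∈ eigs (B i), ‖l‖ = r) ∧
      ∀ᶠ j in atTop, c ≤ ‖(growthScale r M j)⁻¹ • powVec (B i) j (x i)‖ ∧
        ‖(growthScale r M j)⁻¹ • powVec (B i) j (x i)‖ ≤ C := by
    intro i
    by_cases hxi : x i = 0
    · exact ⟨0, 0, 0, 0, fun h => absurd hxi h⟩
    · obtain ⟨r, M, S, w, hr, ⟨l, hl⟩, hw, -, c, hc, C, hC⟩ :=
        exists_leading_part_real (h.isUnit hA i) hxi
      exact ⟨r, M, c, C, fun _ => ⟨hr, hc, ⟨l, (hw l hl).2, (hw l hl).1⟩, hC⟩⟩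
  choose r M c C hlead using hlead
  have hne : (Finset.univ.filter fun i => x i ≠ 0).Nonempty := by
    by_contra hemp
    rw [Finset.not_nonempty_iff_eq_empty, Finset.filter_eq_empty_iff] at hemp
    refine hv (hx.trans (Finset.sum_eq_zero fun i hi => ?_))
    rw [not_not.1 (hemp hi), map_zero]
  obtain ⟨i₀, hi₀, hmax⟩ := Finset.exists_max_image _ r hne
  replace hi₀ := (Finset.mem_filter.1 hi₀).2
  obtain ⟨hr₀, hc₀, ⟨l₀, hl₀, hl₀r⟩, hC₀⟩ := hlead i₀ hi₀
  refine ⟨i₀, x i₀, hi₀, ?_⟩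
  set g : ℕ → ℝ := fun j => growthScale (r i₀) (M i₀) j with hg
  set p : ℕ → EuclideanSpace ℝ (Fin d) := fun j => (g j)⁻¹ • powVec A j v with hp
  set q : ℕ → EuclideanSpace ℝ (Fin d) := fun j =>
    (g j)⁻¹ • powVec A j (Matrix.toEuclideanLin (Q i₀) (x i₀)) with hq
  have hqbd : ∀ᶠ j in atTop, c i₀ ≤ ‖q j‖ ∧ ‖q j‖ ≤ C i₀ := by
    refine hC₀.mono fun j hj => ?_
    have : ‖q j‖ = ‖(g j)⁻¹ • powVec (B i₀) j (x i₀)‖ := by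
      simp only [hq]
      rw [powVec_toEuclideanLin (h.intertwine i₀), ← map_smul, norm_toEuclideanLin
        (h.orthonormal i₀)]
    rw [this]; exact hj
  have hpq : Tendsto (fun j => p j - q j) atTop (𝓝 0) := by
    have hsplit : ∀ j, p j - q j = ∑ i ∈ Finset.univ.erase i₀,
        (g j)⁻¹ • Matrix.toEuclideanLin (Q i) (powVec (B i) j (x i)) := by
      intro j
      have : powVec A j v = ∑ i, powVec A j (Matrix.toEuclideanLin (Q i) (x i)) := by
        conv_lhs => rw [hx]
        exact map_sum (Matrix.toEuclideanLin (A ^ j)) _ _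
      simp only [hp, hq]
      rw [← smul_sub, this, ← Finset.sum_erase_eq_sub (Finset.mem_univ i₀), Finset.smul_sum]
      exact Finset.sum_congr rfl fun i _ => by rw [powVec_toEuclideanLin (h.intertwine i)]
    simp only [hsplit]
    have hterm : ∀ i ∈ Finset.univ.erase i₀, Tendsto (fun j =>
        (g j)⁻¹ • Matrix.toEuclideanLin (Q i) (powVec (B i) j (x i))) atTop (𝓝 0) := by
      intro i hi
      by_cases hxi : x i = 0
      · have : ∀ j, powVec (B i) j (x i) = 0 := fun j => by
          rw [hxi]; exact map_zero (Matrix.toEuclideanLin (B i ^ j))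
        simp [this]
      obtain ⟨hri, -, ⟨l, hl, hlr⟩, hCi⟩ := hlead i hxi
      have hlt : r i < r i₀ := by
        refine lt_of_le_of_ne (hmax i (Finset.mem_filter.2 ⟨Finset.mem_univ _, hxi⟩)) fun heq => ?_
        exact (Finset.mem_erase.1 hi).1 (h.eq_of_norm_eq hl hl₀ (by rw [hlr, hl₀r, heq]))
      rw [tendsto_zero_iff_norm_tendsto_zero]
      have hlim := (tendsto_growthScale_div hri hlt (M i₀) (M i)).mul_const (C i)
      rw [zero_mul] at hlim
      refine squeeze_zero' (Eventually.of_forall fun j => norm_nonneg _) ?_ hlim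
      filter_upwards [hCi, eventually_ge_atTop (M i), eventually_ge_atTop (M i₀)] with j hj h1 h2
      have hgi := growthScale_pos hri h1
      have hg0 := growthScale_pos hr₀ h2
      rw [norm_smul, norm_inv, Real.norm_of_nonneg hg0.le, norm_toEuclideanLin (h.orthonormal i)]
      have h3 := hj.2
      rw [norm_smul, norm_inv, Real.norm_of_nonneg hgi.le, inv_mul_le_iff₀ hgi] at h3
      rw [inv_mul_le_iff₀ hg0]
      calc ‖powVec (B i) j (x i)‖ ≤ growthScale (r i) (M i) j * C i := h3
        _ = _ := by field_simp
    simpa using tendsto_finsetSum _ hterm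
  refine (tendsto_vecAngle_sub hc₀ hqbd hpq).congr' ?_
  filter_upwards [eventually_ge_atTop (M i₀)] with j hj
  rw [stepAngle_eq_scaled A v hr₀ hj, ← stepAngle_toEuclideanLin (h.orthonormal i₀)
    (h.intertwine i₀), stepAngle_eq_scaled A _ hr₀ hj]

theorem isGreatest_theta (h : IsModulusDecomposition A Q B) (hd : 0 < d) (hA : IsUnit A)
    (τ : AngularType) : IsGreatest (Set.range fun i => theta (B i) τ) (theta A τ) := by
  obtain ⟨Θ, hΘ, hΘub, hΘap⟩ := exists_common_value_of_isUnit hd hA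
  rw [hΘ τ]
  have hle : ∀ i, theta (B i) τ ≤ Θ := by
    intro i
    obtain ⟨Θ', hΘ', -, happ⟩ := exists_common_value_of_isUnit (h.dim_pos i) (h.isUnit hA i)
    rw [hΘ' τ]
    refine le_of_forall_pos_sub_le fun ε hε => ?_
    obtain ⟨x, hx, hxn⟩ := happ ε hε
    refine hΘub _ (toEuclideanLin_ne_zero (h.orthonormal i) hx) _ 0 fun n => ?_
    simp only [stepAngle_toEuclideanLin (h.orthonormal i) (h.intertwine i), add_zero]
    exact hxn n
  have hge : ∀ ε > 0, ∃ i, Θ - ε ≤ theta (B i) τ := by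
    intro ε hε
    obtain ⟨v, hv, hvn⟩ := hΘap (ε / 2) (half_pos hε)
    obtain ⟨i, x, hx, hlim⟩ := h.exists_dominant_block hA hv
    obtain ⟨Θ', hΘ', hub, -⟩ := exists_common_value_of_isUnit (h.dim_pos i) (h.isUnit hA i)
    obtain ⟨C, hC⟩ := exists_sum_le_of_tendsto_sub hlim (half_pos hε)
    refine ⟨i, ?_⟩
    rw [hΘ' τ]
    refine hub x hx _ C fun n => ?_
    have h1 := hvn n
    have h2 := hC n
    linarith
  obtain ⟨i₁, -⟩ := hge 1 one_pos
  have : Nonempty (Fin k) := ⟨i₁⟩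
  obtain ⟨i, hi⟩ := Finite.exists_max fun i => theta (B i) τ
  refine ⟨⟨i, le_antisymm (hle i) (le_of_forall_pos_sub_le fun ε hε => ?_)⟩, ?_⟩
  · obtain ⟨i', hi'⟩ := hge ε hε
    exact hi'.trans (hi i')
  · rintro _ ⟨i, rfl⟩
    exact hle i

end IsModulusDecomposition

/-! ### Angles along an ellipse -/

section Ellipse

variable {E : Type*} [NormedAddCommGroup E] [InnerProductSpace ℝ E]

/-- The standard parametrization of the ellipse with conjugate half diameters `a` and `b`. It may be
degenerate. -/
def ellipse (a b : E) (s : ℝ) : E := Real.cos s • a + Real.sin s • b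

/-- Half the sum of the squared half diameters. -/
def ellipseSum (a b : E) : ℝ := (‖a‖ ^ 2 + ‖b‖ ^ 2) / 2

/-- The area of the parallelogram spanned by the half diameters. -/
def ellipseArea (a b : E) : ℝ := √(‖a‖ ^ 2 * ‖b‖ ^ 2 - inner ℝ a b ^ 2)

lemma ellipseArea_nonneg (a b : E) : 0 ≤ ellipseArea a b := Real.sqrt_nonneg _

lemma ellipseArea_sq (a b : E) :
    ellipseArea a b ^ 2 = ‖a‖ ^ 2 * ‖b‖ ^ 2 - inner ℝ a b ^ 2 := by
  refine Real.sq_sqrt (sub_nonneg.2 ?_)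
  rw [← mul_pow, ← sq_abs (inner ℝ a b)]
  exact pow_le_pow_left₀ (abs_nonneg _) (abs_real_inner_le_norm a b) 2

lemma inner_ellipse (a b : E) (s t : ℝ) : inner ℝ (ellipse a b s) (ellipse a b t) =
    Real.cos s * Real.cos t * ‖a‖ ^ 2 + Real.sin s * Real.sin t * ‖b‖ ^ 2 +
      (Real.sin s * Real.cos t + Real.cos s * Real.sin t) * inner ℝ a b := by
  simp only [ellipse, inner_add_left, inner_add_right, real_inner_smul_left, real_inner_smul_right,
    real_inner_self_eq_norm_sq, real_inner_comm a b]
  ring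

lemma norm_ellipse_sq (a b : E) (s : ℝ) : ‖ellipse a b s‖ ^ 2 =
    Real.cos s ^ 2 * ‖a‖ ^ 2 + Real.sin s ^ 2 * ‖b‖ ^ 2 +
      2 * (Real.sin s * Real.cos s) * inner ℝ a b := by
  rw [← real_inner_self_eq_norm_sq, inner_ellipse]; ring

/-- The Gram determinant of two points of an ellipse. -/
lemma gram_ellipse (a b : E) (s t : ℝ) :
    (‖ellipse a b s‖ * ‖ellipse a b t‖) ^ 2 - inner ℝ (ellipse a b s) (ellipse a b t) ^ 2 =
      (ellipseArea a b * Real.sin (t - s)) ^ 2 := by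
  rw [mul_pow, mul_pow, norm_ellipse_sq, norm_ellipse_sq, inner_ellipse, ellipseArea_sq,
    Real.sin_sub]
  ring

lemma vecAngle_eq_zero_of_sq {x y : E} (hx : x ≠ 0) (hy : y ≠ 0)
    (h : (‖x‖ * ‖y‖) ^ 2 - inner ℝ x y ^ 2 = 0) : vecAngle x y = 0 := by
  have h1 : |inner ℝ x y| = ‖x‖ * ‖y‖ := by
    rw [← abs_of_nonneg (mul_nonneg (norm_nonneg x) (norm_nonneg y))]
    exact (sq_eq_sq_iff_abs_eq_abs _ _).1 (by linarith)
  rw [vecAngle, h1, div_self (mul_ne_zero (norm_ne_zero_iff.2 hx) (norm_ne_zero_iff.2 hy)),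
    Real.arccos_one]

/-- A nondegenerate ellipse has a polar angle of the form `s + h s` with a bounded function `h`.
In complex coordinates of its plane the ellipse is a multiple of
`exp (i s) + γ exp (-i s) = exp (i s) (1 + γ exp (-2 i s))` with `|γ| < 1`, and `h` is the argument
of the second factor, which lies in the right half plane. -/
theorem exists_polar_angle {a b : E} (hD : 0 < ellipseArea a b) :
    ∃ h : ℝ → ℝ, (∀ s, |h s| < Real.pi / 2) ∧ ∀ s t,
      inner ℝ (ellipse a b s) (ellipse a b t) = ‖ellipse a b s‖ * ‖ellipse a b t‖ *
        Real.cos (t + h t - (s + h s)) ∧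
      ellipseArea a b * Real.sin (t - s) = ‖ellipse a b s‖ * ‖ellipse a b t‖ *
        Real.sin (t + h t - (s + h s)) := by
  set D := ellipseArea a b with hDdef
  set T := ellipseSum a b with hTdef
  have hD2 : D ^ 2 = ‖a‖ ^ 2 * ‖b‖ ^ 2 - inner ℝ a b ^ 2 := ellipseArea_sq a b
  have hT : 2 * T = ‖a‖ ^ 2 + ‖b‖ ^ 2 := by rw [hTdef, ellipseSum]; ring
  set P : ℝ := (‖a‖ ^ 2 - ‖b‖ ^ 2) / 2 with hP
  set R : ℝ := inner ℝ a b with hR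
  have hT0 : 0 ≤ T := by rw [hTdef, ellipseSum]; positivity
  have hTD : 0 < T + D := by linarith
  have hPR : P ^ 2 + R ^ 2 = T ^ 2 - D ^ 2 := by
    rw [hD2, hP, show T = (‖a‖ ^ 2 + ‖b‖ ^ 2) / 2 from rfl]; ring
  set γ : ℂ := ⟨P / (T + D), R / (T + D)⟩ with hγ
  have hγn : Complex.normSq γ = (T - D) / (T + D) := by
    rw [Complex.normSq_mk]
    field_simp
    linarith
  have hγ1 : ‖γ‖ < 1 := by
    rw [← sq_lt_one_iff₀ (norm_nonneg _), Complex.sq_norm, hγn, div_lt_one hTD]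
    linarith
  let f : ℝ → ℂ := fun s => 1 + γ * Complex.exp ((-(2 * s) : ℝ) * Complex.I)
  let w : ℝ → ℂ := fun s => Complex.exp ((s : ℝ) * Complex.I) * f s
  have hf : ∀ s, 0 < (f s).re := by
    intro s
    have h1 : |(γ * Complex.exp ((-(2 * s) : ℝ) * Complex.I)).re| < 1 := by
      refine (Complex.abs_re_le_norm _).trans_lt ?_
      rwa [norm_mul, Complex.norm_exp_ofReal_mul_I, mul_one]
    have := (abs_lt.1 h1).1
    simp only [f, Complex.add_re, Complex.one_re]
    linarith
  refine ⟨fun s => (f s).arg, fun s => Complex.abs_arg_lt_pi_div_two_iff.2 (Or.inl (hf s)), ?_⟩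
  -- the two real coordinates of `w`
  have hw : ∀ s, w s = ⟨Real.cos s + (P * Real.cos s + R * Real.sin s) / (T + D),
      Real.sin s + (R * Real.cos s - P * Real.sin s) / (T + D)⟩ := by
    intro s
    have h1 : w s = Complex.exp ((s : ℝ) * Complex.I) +
        γ * Complex.exp (((-s : ℝ) : ℂ) * Complex.I) := by
      simp only [w, f]
      rw [mul_add, mul_one, mul_left_comm, ← Complex.exp_add]
      congr 3
      push_cast
      ring
    rw [h1]
    apply Complex.ext
    · simp only [Complex.add_re, Complex.mul_re, Complex.exp_ofReal_mul_I_re,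
        Complex.exp_ofReal_mul_I_im, hγ, Real.cos_neg, Real.sin_neg]
      ring
    · simp only [Complex.add_im, Complex.mul_im, Complex.exp_ofReal_mul_I_re,
        Complex.exp_ofReal_mul_I_im, hγ, Real.cos_neg, Real.sin_neg]
      ring
  have hpolar : ∀ s, w s = (‖w s‖ : ℂ) * Complex.exp (((s + (f s).arg : ℝ) : ℂ) * Complex.I) := by
    intro s
    have h1 : ‖w s‖ = ‖f s‖ := by
      simp only [w]; rw [norm_mul, Complex.norm_exp_ofReal_mul_I, one_mul]
    rw [h1]
    push_cast
    rw [add_mul, Complex.exp_add, mul_left_comm, Complex.norm_mul_exp_arg_mul_I]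
  have hre : ∀ s t, (w s).re * (w t).re + (w s).im * (w t).im =
      ‖w s‖ * ‖w t‖ * Real.cos (t + (f t).arg - (s + (f s).arg)) := by
    intro s t
    rw [Real.cos_sub]
    have hs := hpolar s
    have ht := hpolar t
    have e1 := congrArg Complex.re hs
    have e2 := congrArg Complex.im hs
    have e3 := congrArg Complex.re ht
    have e4 := congrArg Complex.im ht
    rw [Complex.re_ofReal_mul, Complex.exp_ofReal_mul_I_re] at e1 e3
    rw [Complex.im_ofReal_mul, Complex.exp_ofReal_mul_I_im] at e2 e4
    rw [e1, e2, e3, e4]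
    ring
  have him : ∀ s t, (w s).re * (w t).im - (w s).im * (w t).re =
      ‖w s‖ * ‖w t‖ * Real.sin (t + (f t).arg - (s + (f s).arg)) := by
    intro s t
    rw [Real.sin_sub]
    have hs := hpolar s
    have ht := hpolar t
    have e1 := congrArg Complex.re hs
    have e2 := congrArg Complex.im hs
    have e3 := congrArg Complex.re ht
    have e4 := congrArg Complex.im ht
    rw [Complex.re_ofReal_mul, Complex.exp_ofReal_mul_I_re] at e1 e3
    rw [Complex.im_ofReal_mul, Complex.exp_ofReal_mul_I_im] at e2 e4
    rw [e1, e2, e3, e4]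
    ring
  -- `w` is similar to the ellipse
  have ha2 : ‖a‖ ^ 2 = T + P := by rw [hP]; linarith
  have hb2 : ‖b‖ ^ 2 = T - P := by rw [hP]; linarith
  have hin : ∀ s t, inner ℝ (ellipse a b s) (ellipse a b t) =
      (T + D) / 2 * ((w s).re * (w t).re + (w s).im * (w t).im) := by
    intro s t
    rw [inner_ellipse, hw, hw, ha2, hb2]
    field_simp
    linear_combination (-(Real.cos s * Real.cos t) - Real.sin s * Real.sin t) * hPR
  have hcr : ∀ s t, D * Real.sin (t - s) =
      (T + D) / 2 * ((w s).re * (w t).im - (w s).im * (w t).re) := by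
    intro s t
    rw [hw, hw, Real.sin_sub]
    field_simp
    linear_combination (Real.cos s * Real.sin t - Real.sin s * Real.cos t) * hPR
  have hnorm : ∀ s t, ‖ellipse a b s‖ * ‖ellipse a b t‖ = (T + D) / 2 * (‖w s‖ * ‖w t‖) := by
    have h1 : ∀ s, ‖ellipse a b s‖ = √((T + D) / 2) * ‖w s‖ := by
      intro s
      rw [← abs_of_nonneg (norm_nonneg (ellipse a b s)),
        ← abs_of_nonneg (mul_nonneg (Real.sqrt_nonneg ((T + D) / 2)) (norm_nonneg (w s)))]
      rw [← sq_eq_sq_iff_abs_eq_abs, mul_pow, Real.sq_sqrt (by linarith),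
        ← real_inner_self_eq_norm_sq, hin, Complex.sq_norm, Complex.normSq_apply]
    intro s t
    rw [h1, h1]
    have h2 := Real.mul_self_sqrt (show 0 ≤ (T + D) / 2 by linarith)
    linear_combination (‖w s‖ * ‖w t‖) * h2
  intro s t
  constructor
  · rw [hin, hnorm, hre]; ring
  · rw [hcr, hnorm, him]; ring

lemma ellipse_ne_zero {a b : E} (hD : 0 < ellipseArea a b) (s : ℝ) : ellipse a b s ≠ 0 := by
  intro h
  have h1 := gram_ellipse a b s (s + Real.pi / 2)
  rw [h, add_sub_cancel_left, Real.sin_pi_div_two, norm_zero, inner_zero_left] at h1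
  have : 0 < ellipseArea a b ^ 2 := by positivity
  linarith

/-- The increments of the polar angle under a shift of the parameter by `φ ∈ (0, π)` lie
in `(0, π)`, since the cross product of two points keeps its sign. -/
theorem exists_polar_increment {a b : E} (hD : 0 < ellipseArea a b) {φ : ℝ} (h0 : 0 < φ)
    (hπ : φ < Real.pi) :
    ∃ h : ℝ → ℝ, (∀ s, |h s| < Real.pi / 2) ∧ ∀ s,
      0 < φ + h (s + φ) - h s ∧ φ + h (s + φ) - h s < Real.pi ∧
      inner ℝ (ellipse a b s) (ellipse a b (s + φ)) = ‖ellipse a b s‖ * ‖ellipse a b (s + φ)‖ *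
        Real.cos (φ + h (s + φ) - h s) := by
  obtain ⟨h, hh, hst⟩ := exists_polar_angle hD
  refine ⟨h, hh, fun s => ?_⟩
  obtain ⟨h1, h2⟩ := hst s (s + φ)
  rw [show s + φ + h (s + φ) - (s + h s) = φ + h (s + φ) - h s by ring] at h1 h2
  rw [add_sub_cancel_left] at h2
  have hpos : 0 < ‖ellipse a b s‖ * ‖ellipse a b (s + φ)‖ :=
    mul_pos (norm_pos_iff.2 (ellipse_ne_zero hD s)) (norm_pos_iff.2 (ellipse_ne_zero hD _))
  have hsin : 0 < Real.sin (φ + h (s + φ) - h s) := by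
    refine pos_of_mul_pos_right ?_ hpos.le
    rw [← h2]
    exact mul_pos hD (Real.sin_pos_of_pos_of_lt_pi h0 hπ)
  have b1 := abs_lt.1 (hh s)
  have b2 := abs_lt.1 (hh (s + φ))
  refine ⟨?_, ?_, h1⟩
  · by_contra hneg
    have := Real.sin_nonpos_of_nonpos_of_neg_pi_le (not_lt.1 hneg) (by linarith)
    linarith
  · by_contra hge
    have := Real.sin_nonneg_of_nonneg_of_le_pi
      (x := φ + h (s + φ) - h s - Real.pi) (by linarith) (by linarith)
    rw [Real.sin_sub_pi] at this
    linarith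

lemma sum_increments (h : ℝ → ℝ) (s φ : ℝ) (n : ℕ) :
    ∑ j ∈ Finset.range n, (φ + h (s + j * φ + φ) - h (s + j * φ)) =
      n * φ + (h (s + n * φ) - h s) := by
  induction n with
  | zero => simp
  | succ n ih =>
    rw [Finset.sum_range_succ, ih]
    push_cast
    rw [show s + ((n : ℝ) + 1) * φ = s + n * φ + φ by ring]
    ring

lemma vecAngle_of_inner_eq {x y : E} (hx : x ≠ 0) (hy : y ≠ 0) {Δ : ℝ}
    (h : inner ℝ x y = ‖x‖ * ‖y‖ * Real.cos Δ) : vecAngle x y = Real.arccos |Real.cos Δ| := by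
  have hpos : 0 < ‖x‖ * ‖y‖ := mul_pos (norm_pos_iff.2 hx) (norm_pos_iff.2 hy)
  rw [vecAngle, h, abs_mul, abs_of_pos hpos, mul_div_cancel_left₀ _ hpos.ne']

lemma arccos_abs_cos_le {Δ : ℝ} (h0 : 0 ≤ Δ) (hπ : Δ ≤ Real.pi) :
    Real.arccos |Real.cos Δ| ≤ Δ ∧ Real.arccos |Real.cos Δ| ≤ Real.pi - Δ := by
  constructor
  · calc Real.arccos |Real.cos Δ| ≤ Real.arccos (Real.cos Δ) :=
          Real.arccos_le_arccos (le_abs_self _)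
      _ = Δ := Real.arccos_cos h0 hπ
  · calc Real.arccos |Real.cos Δ| ≤ Real.arccos (-Real.cos Δ) :=
          Real.arccos_le_arccos (neg_le_abs _)
      _ = Real.pi - Δ := by rw [Real.arccos_neg, Real.arccos_cos h0 hπ]

/-- The average angle along an ellipse that is traversed with constant parameter speed `φ` is at
most `min φ (π - φ)`. -/
theorem sum_vecAngle_ellipse_le {a b : E} {φ : ℝ} (h0 : 0 ≤ φ) (hπ : φ ≤ Real.pi) (s : ℝ)
    (hne : ∀ j : ℕ, ellipse a b (s + j * φ) ≠ 0) (n : ℕ) :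
    ∑ j ∈ Finset.range n, vecAngle (ellipse a b (s + j * φ)) (ellipse a b (s + j * φ + φ)) ≤
      n * min φ (Real.pi - φ) + Real.pi := by
  by_cases hdeg : ellipseArea a b * Real.sin φ = 0
  · have hz : ∀ j ∈ Finset.range n,
        vecAngle (ellipse a b (s + j * φ)) (ellipse a b (s + j * φ + φ)) = 0 := by
      intro j _
      have h1 := hne (j + 1)
      rw [show s + ((j + 1 : ℕ) : ℝ) * φ = s + j * φ + φ by push_cast; ring] at h1
      refine vecAngle_eq_zero_of_sq (hne j) h1 ?_
      rw [gram_ellipse, add_sub_cancel_left, hdeg]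
      norm_num
    rw [Finset.sum_eq_zero hz]
    have : 0 ≤ min φ (Real.pi - φ) := le_min h0 (by linarith)
    have := Real.pi_pos
    positivity
  · have hD : 0 < ellipseArea a b :=
      (ellipseArea_nonneg a b).lt_of_ne' fun h => hdeg (by rw [h, zero_mul])
    have h0' : 0 < φ := h0.lt_of_ne' fun h => hdeg (by rw [h, Real.sin_zero, mul_zero])
    have hπ' : φ < Real.pi := hπ.lt_of_ne fun h => hdeg (by rw [h, Real.sin_pi, mul_zero])
    obtain ⟨h, hh, hs⟩ := exists_polar_increment hD h0' hπ'
    have hstep : ∀ j : ℕ, vecAngle (ellipse a b (s + j * φ)) (ellipse a b (s + j * φ + φ)) ≤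
        φ + h (s + j * φ + φ) - h (s + j * φ) ∧
        vecAngle (ellipse a b (s + j * φ)) (ellipse a b (s + j * φ + φ)) ≤
        Real.pi - (φ + h (s + j * φ + φ) - h (s + j * φ)) := by
      intro j
      obtain ⟨g1, g2, g3⟩ := hs (s + j * φ)
      rw [vecAngle_of_inner_eq (ellipse_ne_zero hD _) (ellipse_ne_zero hD _) g3]
      exact arccos_abs_cos_le g1.le g2.le
    have hsum := sum_increments h s φ n
    have b1 := abs_lt.1 (hh s)
    have b2 := abs_lt.1 (hh (s + n * φ))
    have e1 := Finset.sum_le_sum fun j (_ : j ∈ Finset.range n) => (hstep j).1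
    have e2 := Finset.sum_le_sum fun j (_ : j ∈ Finset.range n) => (hstep j).2
    rw [Finset.sum_sub_distrib, hsum, Finset.sum_const, Finset.card_range, nsmul_eq_mul] at e2
    rw [hsum] at e1
    rcases min_choice φ (Real.pi - φ) with hm | hm <;> rw [hm] <;> linarith

/-- If the ellipse is not too eccentric relative to `φ`, its points at parameters `s` and `s + φ`
enclose for all `s` an angle on the same side of `π / 2`, and the average angle is
`min φ (π - φ)`. -/
theorem le_sum_vecAngle_ellipse {a b : E} (hD : 0 < ellipseArea a b) {φ : ℝ} (h0 : 0 < φ)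
    (hπ : φ < Real.pi) (hecc : ellipseSum a b * Real.sin φ ≤ ellipseArea a b) (s : ℝ) (n : ℕ) :
    n * min φ (Real.pi - φ) - Real.pi ≤
      ∑ j ∈ Finset.range n, vecAngle (ellipse a b (s + j * φ)) (ellipse a b (s + j * φ + φ)) := by
  obtain ⟨h, hh, hs⟩ := exists_polar_increment hD h0 hπ
  have hsum := sum_increments h s φ n
  have b1 := abs_lt.1 (hh s)
  have b2 := abs_lt.1 (hh (s + n * φ))
  have hsin : 0 < Real.sin φ := Real.sin_pos_of_pos_of_lt_pi h0 hπ
  have hT0 : 0 ≤ ellipseSum a b := by rw [ellipseSum]; positivity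
  set P : ℝ := (‖a‖ ^ 2 - ‖b‖ ^ 2) / 2 with hP
  set R : ℝ := inner ℝ a b with hR
  -- the inner product oscillates about its mean with an amplitude that does not exceed the mean
  have hosc : ∀ s, |inner ℝ (ellipse a b s) (ellipse a b (s + φ)) -
      ellipseSum a b * Real.cos φ| ≤ |ellipseSum a b * Real.cos φ| := by
    intro s
    have e0 : ∀ t, inner ℝ (ellipse a b s) (ellipse a b t) - ellipseSum a b * Real.cos (t - s) =
        P * Real.cos (s + t) + R * Real.sin (s + t) := by
      intro t
      rw [inner_ellipse, Real.cos_add, Real.sin_add, Real.cos_sub, hP, hR, ellipseSum]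
      ring
    have e1 := e0 (s + φ)
    rw [add_sub_cancel_left] at e1
    rw [← sq_le_sq, e1]
    have e2 := Real.sin_sq_add_cos_sq (s + (s + φ))
    have e3 := Real.sin_sq_add_cos_sq φ
    have e4 : P ^ 2 + R ^ 2 = ellipseSum a b ^ 2 - ellipseArea a b ^ 2 := by
      rw [ellipseArea_sq, ellipseSum, hP, hR]; ring
    have e5 : (ellipseSum a b * Real.sin φ) ^ 2 ≤ ellipseArea a b ^ 2 :=
      pow_le_pow_left₀ (mul_nonneg hT0 hsin.le) hecc 2
    have e6 := sq_nonneg (P * Real.sin (s + (s + φ)) - R * Real.cos (s + (s + φ)))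
    calc (P * Real.cos (s + (s + φ)) + R * Real.sin (s + (s + φ))) ^ 2
        ≤ (P ^ 2 + R ^ 2) * (Real.sin (s + (s + φ)) ^ 2 + Real.cos (s + (s + φ)) ^ 2) := by
          linarith
      _ = ellipseSum a b ^ 2 - ellipseArea a b ^ 2 := by rw [e2, e4, mul_one]
      _ ≤ ellipseSum a b ^ 2 * (1 - Real.sin φ ^ 2) := by linarith
      _ = (ellipseSum a b * Real.cos φ) ^ 2 := by
          rw [mul_pow, ← e3]; ring
  have hnn : ∀ s t, 0 < ‖ellipse a b s‖ * ‖ellipse a b t‖ := fun s t =>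
    mul_pos (norm_pos_iff.2 (ellipse_ne_zero hD s)) (norm_pos_iff.2 (ellipse_ne_zero hD t))
  rcases le_or_gt 0 (Real.cos φ) with hc | hc
  · have hstep : ∀ j ∈ Finset.range n, φ + h (s + j * φ + φ) - h (s + j * φ) ≤
        vecAngle (ellipse a b (s + j * φ)) (ellipse a b (s + j * φ + φ)) := by
      intro j _
      obtain ⟨g1, g2, g3⟩ := hs (s + j * φ)
      have g4 := hosc (s + j * φ)
      rw [abs_of_nonneg (mul_nonneg hT0 hc)] at g4
      have g5 : 0 ≤ Real.cos (φ + h (s + j * φ + φ) - h (s + j * φ)) := by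
        refine nonneg_of_mul_nonneg_right ?_ (hnn (s + j * φ) (s + j * φ + φ))
        rw [← g3]
        linarith [(abs_le.1 g4).1]
      rw [vecAngle_of_inner_eq (ellipse_ne_zero hD _) (ellipse_ne_zero hD _) g3, abs_of_nonneg g5,
        Real.arccos_cos g1.le g2.le]
    have e1 := Finset.sum_le_sum hstep
    rw [hsum] at e1
    have e2 : (n : ℝ) * min φ (Real.pi - φ) ≤ n * φ := by gcongr; exact min_le_left _ _
    linarith
  · have hstep : ∀ j ∈ Finset.range n, Real.pi - (φ + h (s + j * φ + φ) - h (s + j * φ)) ≤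
        vecAngle (ellipse a b (s + j * φ)) (ellipse a b (s + j * φ + φ)) := by
      intro j _
      obtain ⟨g1, g2, g3⟩ := hs (s + j * φ)
      have g4 := hosc (s + j * φ)
      rw [abs_of_nonpos (mul_nonpos_of_nonneg_of_nonpos hT0 hc.le)] at g4
      have g5 : Real.cos (φ + h (s + j * φ + φ) - h (s + j * φ)) ≤ 0 := by
        refine nonpos_of_mul_nonpos_right ?_ (hnn (s + j * φ) (s + j * φ + φ))
        rw [← g3]
        linarith [(abs_le.1 g4).2]
      rw [vecAngle_of_inner_eq (ellipse_ne_zero hD _) (ellipse_ne_zero hD _) g3, abs_of_nonpos g5,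
        Real.arccos_neg, Real.arccos_cos g1.le g2.le]
    have e1 := Finset.sum_le_sum hstep
    rw [Finset.sum_sub_distrib, hsum, Finset.sum_const, Finset.card_range, nsmul_eq_mul] at e1
    have e2 : (n : ℝ) * min φ (Real.pi - φ) ≤ n * (Real.pi - φ) := by
      gcongr; exact min_le_right _ _
    linarith

end Ellipse

/-! ### Rotations by complex eigenvalues in real coordinates -/

/-- The orientation in which multiplication by `l` rotates, so that `arg l = ± |arg l|`. -/
def argSign (l : ℂ) : ℝ := if 0 ≤ l.arg then 1 else -1

lemma argSign_mul_self (l : ℂ) : argSign l * argSign l = 1 := by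
  rw [argSign]; split_ifs <;> norm_num

lemma argSign_mul_abs (l : ℂ) : argSign l * |l.arg| = l.arg := by
  rw [argSign]
  split_ifs with h
  · rw [abs_of_nonneg h, one_mul]
  · rw [abs_of_neg (not_le.1 h)]; ring

lemma cos_mul_arg (l : ℂ) (x : ℝ) : Real.cos (x * l.arg) = Real.cos (x * |l.arg|) := by
  rw [← Real.cos_abs, ← Real.cos_abs (x * |l.arg|), abs_mul, abs_mul, abs_abs]

lemma sin_mul_arg (l : ℂ) (x : ℝ) :
    Real.sin (x * l.arg) = argSign l * Real.sin (x * |l.arg|) := by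
  conv_lhs => rw [← argSign_mul_abs l]
  rw [argSign]
  split_ifs
  · rw [one_mul, one_mul]
  · rw [neg_one_mul, mul_neg, Real.sin_neg, neg_one_mul]

lemma div_norm_pow {l : ℂ} (hl : l ≠ 0) (j : ℕ) :
    (l / (‖l‖ : ℂ)) ^ j = Complex.exp (((j * l.arg : ℝ) : ℂ) * Complex.I) := by
  have h : l / (‖l‖ : ℂ) = Complex.exp (l.arg * Complex.I) := by
    have h0 : (‖l‖ : ℂ) ≠ 0 := by exact_mod_cast norm_ne_zero_iff.2 hl
    rw [div_eq_iff h0, mul_comm, Complex.norm_mul_exp_arg_mul_I]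
  rw [h, ← Complex.exp_nat_mul]
  congr 1
  push_cast
  ring

lemma re_div_norm_pow_mul {l : ℂ} (hl : l ≠ 0) (j : ℕ) (z : ℂ) :
    ((l / (‖l‖ : ℂ)) ^ j * z).re =
      Real.cos (j * |l.arg|) * z.re + Real.sin (j * |l.arg|) * (-(argSign l * z.im)) := by
  rw [div_norm_pow hl, Complex.mul_re, Complex.exp_ofReal_mul_I_re, Complex.exp_ofReal_mul_I_im,
    cos_mul_arg, sin_mul_arg]
  ring

section Spectrum

variable {d : ℕ} {A : Matrix (Fin d) (Fin d) ℝ}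

/-- The common value is bounded by any bound for the average angles along all orbits. -/
lemma le_of_average_le {Θ m : ℝ}
    (happ : ∀ ε > 0, ∃ v : EuclideanSpace ℝ (Fin d), v ≠ 0 ∧
        ∀ n : ℕ, n * (Θ - ε) ≤ ∑ i ∈ Finset.range n, stepAngle A v i)
    (hm : ∀ v : EuclideanSpace ℝ (Fin d), v ≠ 0 → ∀ ε > 0, ∃ C : ℝ, ∀ n : ℕ,
      ∑ i ∈ Finset.range n, stepAngle A v i ≤ n * m + ε * n + C) : Θ ≤ m := by
  refine le_of_forall_pos_le_add fun ε hε => ?_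
  obtain ⟨v, hv, hvn⟩ := happ (ε / 3) (by positivity)
  obtain ⟨C, hC⟩ := hm v hv (ε / 3) (by positivity)
  by_contra hlt
  obtain ⟨n, hn⟩ := exists_nat_gt (C / (ε / 3))
  rw [div_lt_iff₀ (by positivity)] at hn
  have h1 := hvn n
  have h2 := hC n
  have h3 : (n : ℝ) * (m + ε) ≤ n * Θ := by gcongr; exact (not_le.1 hlt).le
  linarith

/-- If eigenvalues of equal modulus have equal `|arg|`, the leading part of an orbit runs along
an ellipse, and the average angle is at most `min |arg l| (π - |arg l|)` for some eigenvalue. -/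
theorem exists_sum_stepAngle_le (hA : IsUnit A)
    (harg : ∀ l ∈ eigs A, ∀ l' ∈ eigs A, ‖l‖ = ‖l'‖ → |l.arg| = |l'.arg|)
    {v : EuclideanSpace ℝ (Fin d)} (hv : v ≠ 0) :
    ∃ l ∈ eigs A, ∀ ε > 0, ∃ C : ℝ, ∀ n : ℕ,
      ∑ i ∈ Finset.range n, stepAngle A v i ≤ n * rotationAngle l + ε * n + C := by
  obtain ⟨r, M, S, w, hr, ⟨l₀, hl₀⟩, hw, hlim, c, hc, C, hcC⟩ := exists_leading_part_real hA hv
  obtain ⟨K, hK, hK1, -⟩ := exists_norm_complexify_bounds (d := d)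
  refine ⟨l₀, (hw l₀ hl₀).2, fun ε hε => ?_⟩
  set φ := |l₀.arg| with hφ
  set p : ℕ → EuclideanSpace ℝ (Fin d) := fun j => (growthScale r M j)⁻¹ • powVec A j v with hp
  let a : EuclideanSpace ℝ (Fin d) := WithLp.toLp 2 fun i => ∑ l ∈ S, (w l i).re
  let b : EuclideanSpace ℝ (Fin d) := WithLp.toLp 2 fun i => ∑ l ∈ S, -(argSign l * (w l i).im)
  let q : ℕ → EuclideanSpace ℝ (Fin d) := fun j => ellipse a b (j * φ)
  have hqre : ∀ j i, q j i = ((∑ l ∈ S, (l / r) ^ j • w l) i).re := by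
    intro j i
    have h1 : ∀ l ∈ S, (((l / r) ^ j • w l) i).re =
        Real.cos (j * φ) * (w l i).re + Real.sin (j * φ) * (-(argSign l * (w l i).im)) := by
      intro l hl
      have hl0 : l ≠ 0 := norm_pos_iff.1 (by rw [(hw l hl).1]; exact hr)
      have h2 : |l.arg| = φ :=
        harg l (hw l hl).2 l₀ (hw l₀ hl₀).2 ((hw l hl).1.trans (hw l₀ hl₀).1.symm)
      rw [← h2, Pi.smul_apply, smul_eq_mul, ← (hw l hl).1]
      exact re_div_norm_pow_mul hl0 j _
    rw [Finset.sum_apply, Complex.re_sum, Finset.sum_congr rfl h1, Finset.sum_add_distrib,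
      ← Finset.mul_sum, ← Finset.mul_sum]
    simp [q, ellipse, a, b]
  have hqp : Tendsto (fun j => q j - p j) atTop (𝓝 0) := by
    rw [tendsto_zero_iff_norm_tendsto_zero]
    have h1 := (tendsto_zero_iff_norm_tendsto_zero.1 hlim).const_mul K
    rw [mul_zero] at h1
    refine squeeze_zero (fun j => norm_nonneg _) (fun j => ?_) h1
    rw [norm_sub_rev]
    refine (hK1 _).trans ?_
    gcongr
    refine (pi_norm_le_iff_of_nonneg (norm_nonneg _)).2 fun i => ?_
    refine le_trans ?_ (norm_le_pi_norm _ i)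
    rw [complexify_apply, Complex.norm_real, Real.norm_eq_abs]
    refine le_trans (le_of_eq ?_) (Complex.abs_re_le_norm _)
    rw [Pi.sub_apply, Complex.sub_re, ← hqre, complexify_apply, Complex.ofReal_re]
    rfl
  have hstep : Tendsto (fun j => stepAngle A v j - vecAngle (q j) (q (j + 1))) atTop (𝓝 0) := by
    have h1 := (tendsto_vecAngle_sub hc hcC hqp).neg
    rw [neg_zero] at h1
    refine h1.congr' ?_
    filter_upwards [eventually_ge_atTop M] with j hj
    rw [stepAngle_eq_scaled A v hr hj, neg_sub]
  obtain ⟨C₁, hC₁⟩ := exists_sum_le_of_tendsto_sub hstep hε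
  -- the ellipse avoids the origin from some index on
  have hne : ∀ᶠ j in atTop, q j ≠ 0 := by
    have h1 := (tendsto_zero_iff_norm_tendsto_zero.1 hqp).eventually_lt_const hc
    filter_upwards [h1, hcC] with j hj hj' h0
    rw [h0, zero_sub, norm_neg] at hj
    exact absurd hj'.1 (not_le.2 hj)
  obtain ⟨J, hJ⟩ := eventually_atTop.1 hne
  refine ⟨J * Real.pi + Real.pi + C₁, fun n => (hC₁ n).trans ?_⟩
  have h1 : ∑ j ∈ Finset.range n, vecAngle (q j) (q (j + 1)) ≤
      ∑ j ∈ Finset.range (J + n), vecAngle (q j) (q (j + 1)) :=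
    Finset.sum_le_sum_of_subset_of_nonneg (Finset.range_mono (by omega))
      fun _ _ _ => vecAngle_nonneg _ _
  have h2 : ∑ j ∈ Finset.range J, vecAngle (q j) (q (j + 1)) ≤ J * Real.pi := by
    simpa using Finset.sum_le_card_nsmul (Finset.range J) (fun j => vecAngle (q j) (q (j + 1)))
      Real.pi (fun _ _ => vecAngle_le_pi _ _)
  have hqJ : ∀ j : ℕ, q (J + j) = ellipse a b (J * φ + j * φ) := by
    intro j
    simp only [q]; push_cast; rw [add_mul]
  have h3 := sum_vecAngle_ellipse_le (a := a) (b := b) (abs_nonneg _) (Complex.abs_arg_le_pi l₀)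
    (J * φ) (fun j => by rw [← hφ, ← hqJ]; exact hJ _ (by omega)) n
  have h4 : ∑ j ∈ Finset.range n, vecAngle (q (J + j)) (q (J + j + 1)) =
      ∑ j ∈ Finset.range n, vecAngle (ellipse a b (J * φ + j * φ))
        (ellipse a b (J * φ + j * φ + φ)) := by
    refine Finset.sum_congr rfl fun j _ => ?_
    rw [hqJ, add_assoc J j 1, hqJ]
    push_cast
    rw [show (J : ℝ) * φ + (j + 1) * φ = J * φ + j * φ + φ by ring]
  rw [Finset.sum_range_add, h4] at h1
  have h5 : rotationAngle l₀ = min φ (Real.pi - φ) := rfl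
  rw [h5]
  linarith

/-! ### Real and imaginary parts of eigenvectors -/

/-- The componentwise real part. -/
def rePart (z : Fin d → ℂ) : EuclideanSpace ℝ (Fin d) := WithLp.toLp 2 fun i => (z i).re

/-- The componentwise imaginary part. -/
def imPart (z : Fin d → ℂ) : EuclideanSpace ℝ (Fin d) := WithLp.toLp 2 fun i => (z i).im

lemma toEuclideanLin_rePart (A : Matrix (Fin d) (Fin d) ℝ) (z : Fin d → ℂ) :
    Matrix.toEuclideanLin A (rePart z) = rePart ((toComplex A).mulVec z) := by
  ext i
  simp [rePart, Matrix.toLpLin_apply, Matrix.mulVec, dotProduct]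

lemma toEuclideanLin_imPart (A : Matrix (Fin d) (Fin d) ℝ) (z : Fin d → ℂ) :
    Matrix.toEuclideanLin A (imPart z) = imPart ((toComplex A).mulVec z) := by
  ext i
  simp [imPart, Matrix.toLpLin_apply, Matrix.mulVec, dotProduct]

lemma eq_zero_of_rePart_imPart {z : Fin d → ℂ} (h1 : rePart z = 0) (h2 : imPart z = 0) :
    z = 0 := by
  ext i
  exact Complex.ext (congrArg (fun x : EuclideanSpace ℝ (Fin d) => x i) h1)
    (congrArg (fun x : EuclideanSpace ℝ (Fin d) => x i) h2)

lemma exists_eigenvector {l : ℂ} (hl : l ∈ eigs A) :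
    ∃ z : Fin d → ℂ, z ≠ 0 ∧ (toComplex A).mulVec z = l • z := by
  obtain ⟨z, hz⟩ := ((mem_eigs_iff A l).1 hl).exists_hasEigenvector
  exact ⟨z, hz.2, by simpa using hz.apply_eq_smul⟩

lemma powVec_one (A : Matrix (Fin d) (Fin d) ℝ) (v : EuclideanSpace ℝ (Fin d)) :
    powVec A 1 v = Matrix.toEuclideanLin A v := by rw [powVec, pow_one]

lemma exists_real_eigenvector {t : ℝ} (ht : (t : ℂ) ∈ eigs A) :
    ∃ x : EuclideanSpace ℝ (Fin d), ‖x‖ = 1 ∧ Matrix.toEuclideanLin A x = t • x := by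
  obtain ⟨z, hz, hAz⟩ := exists_eigenvector ht
  have key : ∃ x : EuclideanSpace ℝ (Fin d), x ≠ 0 ∧ Matrix.toEuclideanLin A x = t • x := by
    by_cases h : rePart z = 0
    · refine ⟨imPart z, fun h2 => hz (eq_zero_of_rePart_imPart h h2), ?_⟩
      rw [toEuclideanLin_imPart, hAz]
      ext i; simp [imPart]
    · refine ⟨rePart z, h, ?_⟩
      rw [toEuclideanLin_rePart, hAz]
      ext i; simp [rePart]
  obtain ⟨x, hx, hAx⟩ := key
  refine ⟨(‖x‖⁻¹ : ℝ) • x, by rw [norm_smul]; simp [hx], ?_⟩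
  rw [map_smul, hAx, smul_comm]

lemma ne_zero_of_mem_eigs (hA : IsUnit A) {l : ℂ} (hl : l ∈ eigs A) : l ≠ 0 := by
  rintro rfl
  obtain ⟨z, hz, hAz⟩ := exists_eigenvector hl
  rw [zero_smul] at hAz
  exact hz (toLin'_toComplex_injective hA (hAz.trans (map_zero (Matrix.toLin' _)).symm))

/-- The sum of unit eigenvectors to `t` and `-t` is turned by a right angle in each step. -/
theorem exists_stepAngle_eq_pi_div_two (hA : IsUnit A) {t : ℝ} (h1 : (t : ℂ) ∈ eigs A)
    (h2 : -(t : ℂ) ∈ eigs A) :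
    ∃ v : EuclideanSpace ℝ (Fin d), v ≠ 0 ∧ ∀ j, stepAngle A v j = Real.pi / 2 := by
  have ht : t ≠ 0 := by
    have := ne_zero_of_mem_eigs hA h1
    exact_mod_cast this
  obtain ⟨x, hx, hAx⟩ := exists_real_eigenvector h1
  obtain ⟨y, hy, hAy⟩ := exists_real_eigenvector (t := -t) (by exact_mod_cast h2)
  have hpow : ∀ j, powVec A j (x + y) = t ^ j • (x + (-1 : ℝ) ^ j • y) := by
    intro j
    induction j with
    | zero => simp [powVec_zero]
    | succ j ih =>
      rw [powVec_add, ih, powVec_one, map_smul, map_add, map_smul, hAx, hAy]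
      simp only [pow_succ]
      module
  have hv : x + y ≠ 0 := by
    intro h
    have h3 := congrArg (Matrix.toEuclideanLin A) h
    rw [map_add, map_zero, hAx, hAy, eq_neg_of_add_eq_zero_right h] at h3
    have h4 : (2 * t) • x = 0 := by rw [← h3]; module
    rcases smul_eq_zero.1 h4 with h5 | h5
    · exact ht (by linarith)
    · rw [h5, norm_zero] at hx; exact zero_ne_one hx
  refine ⟨x + y, hv, fun j => ?_⟩
  rw [stepAngle, hpow, hpow, vecAngle_smul_smul (pow_ne_zero _ ht) (pow_ne_zero _ ht), vecAngle]
  have h5 : inner ℝ (x + (-1 : ℝ) ^ j • y) (x + (-1 : ℝ) ^ (j + 1) • y) = 0 := by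
    simp only [inner_add_left, inner_add_right, real_inner_smul_left, real_inner_smul_right,
      real_inner_self_eq_norm_sq, hx, hy, real_inner_comm x y, pow_succ]
    have h6 : ((-1 : ℝ) ^ j) * (-1) ^ j = 1 := by
      rw [← mul_pow]; norm_num
    linear_combination -h6
  rw [h5, abs_zero, zero_div, Real.arccos_zero]

/-! ### Planes rotated by a nonreal eigenvalue -/

section Plane

variable {E : Type*} [NormedAddCommGroup E] [InnerProductSpace ℝ E] {a b : E} {φ r : ℝ}
  {L : E →ₗ[ℝ] E}

lemma ellipseArea_eq (ha : a ≠ 0) :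
    ellipseArea a b = ‖a‖ * ‖b - (inner ℝ a b / ‖a‖ ^ 2) • a‖ := by
  have hn : ‖a‖ ≠ 0 := norm_ne_zero_iff.2 ha
  refine (sq_eq_sq₀ (ellipseArea_nonneg a b) (by positivity)).1 ?_
  rw [ellipseArea_sq, mul_pow, norm_sub_sq_real, norm_smul, real_inner_smul_right, mul_pow,
    Real.norm_eq_abs, sq_abs, real_inner_comm a b]
  field_simp
  ring

lemma map_ellipse (ha : L a = r • (Real.cos φ • a + Real.sin φ • b))
    (hb : L b = r • (Real.cos φ • b - Real.sin φ • a)) (s : ℝ) :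
    L (ellipse a b s) = r • ellipse a b (s + φ) := by
  rw [ellipse, ellipse, map_add, map_smul, map_smul, ha, hb, Real.cos_add, Real.sin_add]
  module

/-- The invariant plane of a rotation by an angle other than `0` and `π` is nondegenerate. -/
lemma ellipseArea_pos (hr : r ≠ 0) (hφ : Real.sin φ ≠ 0)
    (ha : L a = r • (Real.cos φ • a + Real.sin φ • b))
    (hb : L b = r • (Real.cos φ • b - Real.sin φ • a)) (hab : a ≠ 0 ∨ b ≠ 0) :
    a ≠ 0 ∧ 0 < ellipseArea a b := by
  have ha0 : a ≠ 0 := by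
    rintro rfl
    rw [map_zero, smul_zero, zero_add, smul_smul] at ha
    rcases smul_eq_zero.1 ha.symm with h | h
    · exact mul_ne_zero hr hφ h
    · exact hab.elim (fun h' => h' rfl) fun h' => h' h
  refine ⟨ha0, (ellipseArea_nonneg a b).lt_of_ne' fun h0 => ?_⟩
  rw [ellipseArea_eq ha0, mul_eq_zero, norm_eq_zero, norm_eq_zero, sub_eq_zero] at h0
  obtain ⟨t, ht⟩ : ∃ t : ℝ, b = t • a := ⟨_, h0.resolve_left ha0⟩
  rw [ht, map_smul, ha, ht] at hb
  have h1 : (r * Real.sin φ * (t ^ 2 + 1)) • a = 0 := by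
    rw [← sub_eq_zero] at hb
    rw [← hb]
    module
  rcases smul_eq_zero.1 h1 with h | h
  · exact mul_ne_zero (mul_ne_zero hr hφ) (by positivity) h
  · exact ha0 h

/-- A bound for the skew part of a map bounds the eccentricity of the ellipses it traverses. The
skew form is evaluated at `a` and at the component of `b` orthogonal to `a`. -/
lemma ellipseSum_mul_sin_le (hr : 0 < r) (ha0 : a ≠ 0)
    (ha : L a = r • (Real.cos φ • a + Real.sin φ • b))
    (hb : L b = r • (Real.cos φ • b - Real.sin φ • a))
    (hskew : ∀ x y : E, |inner ℝ (L x) y - inner ℝ x (L y)| ≤ 2 * r * ‖x‖ * ‖y‖) :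
    ellipseSum a b * Real.sin φ ≤ ellipseArea a b := by
  have h1 := hskew a (b - (inner ℝ a b / ‖a‖ ^ 2) • a)
  have h2 : inner ℝ (L a) (b - (inner ℝ a b / ‖a‖ ^ 2) • a) -
      inner ℝ a (L (b - (inner ℝ a b / ‖a‖ ^ 2) • a)) =
      inner ℝ (L a) b - inner ℝ a (L b) := by
    rw [map_sub, map_smul, inner_sub_right, inner_sub_right, real_inner_smul_right,
      real_inner_smul_right, real_inner_comm (L a) a]
    ring
  have h3 : inner ℝ (L a) b - inner ℝ a (L b) = 2 * r * (ellipseSum a b * Real.sin φ) := by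
    rw [ha, hb, real_inner_smul_left, real_inner_smul_right, inner_add_left, inner_sub_right,
      real_inner_smul_left, real_inner_smul_left, real_inner_smul_right, real_inner_smul_right,
      real_inner_self_eq_norm_sq, real_inner_self_eq_norm_sq, ellipseSum]
    ring
  rw [h2, h3, mul_assoc (2 * r), ← ellipseArea_eq ha0] at h1
  exact le_of_mul_le_mul_left ((le_abs_self _).trans h1) (by positivity)

end Plane

lemma inner_toEuclideanLin_sub (A : Matrix (Fin d) (Fin d) ℝ) (x y : EuclideanSpace ℝ (Fin d)) :
    inner ℝ (Matrix.toEuclideanLin A x) y - inner ℝ x (Matrix.toEuclideanLin A y) =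
      inner ℝ (Matrix.toEuclideanLin (A - A.transpose) x) y := by
  simp only [EuclideanSpace.inner_eq_star_dotProduct, star_trivial, Matrix.toLpLin_apply,
    Matrix.sub_mulVec, dotProduct_sub, Matrix.mulVec_transpose]
  rw [dotProduct_comm y.ofLp (Matrix.vecMul x.ofLp A), ← Matrix.dotProduct_mulVec,
    dotProduct_comm (A.mulVec y.ofLp)]

/-- Along the plane of a nonreal eigenvalue of maximal modulus the average angle is the rotation
angle, provided that the skewness is at most one. -/
theorem exists_le_sum_stepAngle {l : ℂ} (hl : l ∈ eigs A) (him : l.im ≠ 0)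
    (hmod : ∀ m ∈ eigs A, ‖m‖ = ‖l‖) (hskew : skew A ≤ 1) :
    ∃ v : EuclideanSpace ℝ (Fin d), v ≠ 0 ∧ ∀ n : ℕ,
      n * rotationAngle l ≤ ∑ j ∈ Finset.range n, stepAngle A v j + Real.pi := by
  obtain ⟨z, hz, hAz⟩ := exists_eigenvector hl
  have hr : 0 < ‖l‖ := norm_pos_iff.2 fun h => him (by rw [h, Complex.zero_im])
  set r := ‖l‖ with hrdef
  set φ := |l.arg| with hφ
  have hφ0 : 0 < φ := abs_pos.2 fun h => him (by
    rw [← Complex.norm_mul_sin_arg, h, Real.sin_zero, mul_zero])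
  have hφπ : φ < Real.pi := (Complex.abs_arg_le_pi l).lt_of_ne fun h => him (by
    have := sin_mul_arg l 1
    rw [one_mul, one_mul, h, Real.sin_pi, mul_zero] at this
    rw [← Complex.norm_mul_sin_arg, this, mul_zero])
  have hre : l.re = r * Real.cos φ := by
    have := cos_mul_arg l 1
    rw [one_mul, one_mul] at this
    rw [← Complex.norm_mul_cos_arg, this]
  have himl : l.im = r * (argSign l * Real.sin φ) := by
    have := sin_mul_arg l 1
    rw [one_mul, one_mul] at this
    rw [← Complex.norm_mul_sin_arg, this]
  have hσ := argSign_mul_self l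
  set a := rePart z with hadef
  set b := -(argSign l • imPart z) with hbdef
  have ha : Matrix.toEuclideanLin A a = r • (Real.cos φ • a + Real.sin φ • b) := by
    rw [hadef, toEuclideanLin_rePart, hAz, hbdef]
    ext i
    simp only [rePart, imPart, Pi.smul_apply, smul_eq_mul, Complex.mul_re, hre, himl,
      PiLp.smul_apply, PiLp.add_apply, PiLp.neg_apply]
    ring
  have hb : Matrix.toEuclideanLin A b = r • (Real.cos φ • b - Real.sin φ • a) := by
    rw [hbdef, map_neg, map_smul, toEuclideanLin_imPart, hAz, hadef]
    ext i
    simp only [rePart, imPart, Pi.smul_apply, smul_eq_mul, Complex.mul_im, hre, himl,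
      PiLp.smul_apply, PiLp.sub_apply, PiLp.neg_apply]
    linear_combination (-(r * Real.sin φ * (z i).re)) * hσ
  have hab : a ≠ 0 ∨ b ≠ 0 := by
    by_contra h
    push Not at h
    have hσ0 : argSign l ≠ 0 := fun h0 => by rw [h0] at hσ; norm_num at hσ
    exact hz (eq_zero_of_rePart_imPart h.1
      ((smul_eq_zero.1 (neg_eq_zero.1 h.2)).resolve_left hσ0))
  obtain ⟨ha0, hD⟩ := ellipseArea_pos hr.ne' (Real.sin_pos_of_pos_of_lt_pi hφ0 hφπ).ne' ha hb hab
  have hnorm : ‖Matrix.toEuclideanCLM (n := Fin d) (𝕜 := ℝ) (A - A.transpose)‖ ≤ 2 * r := by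
    have h1 : (fun l : ℂ => ‖l‖) '' eigs A = {r} := by
      refine Set.eq_singleton_iff_unique_mem.2 ⟨⟨l, hl, rfl⟩, ?_⟩
      rintro _ ⟨m, hm, rfl⟩
      exact hmod m hm
    rw [skew, h1, csSup_singleton, one_div, inv_mul_le_iff₀ (by positivity), mul_one] at hskew
    exact hskew
  have hsk : ∀ x y : EuclideanSpace ℝ (Fin d), |inner ℝ (Matrix.toEuclideanLin A x) y -
      inner ℝ x (Matrix.toEuclideanLin A y)| ≤ 2 * r * ‖x‖ * ‖y‖ := by
    intro x y
    rw [inner_toEuclideanLin_sub]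
    refine (abs_real_inner_le_norm _ _).trans ?_
    gcongr
    exact ((Matrix.toEuclideanCLM (n := Fin d) (𝕜 := ℝ) (A - A.transpose)).le_opNorm x).trans
      (by gcongr)
  have hecc := ellipseSum_mul_sin_le hr ha0 ha hb hsk
  have hpow : ∀ j : ℕ, powVec A j a = r ^ j • ellipse a b (0 + j * φ) := by
    intro j
    induction j with
    | zero => simp [powVec_zero, ellipse]
    | succ j ih =>
      rw [powVec_add, ih, powVec_one, map_smul, map_ellipse ha hb, smul_smul, pow_succ]
      push_cast
      rw [show 0 + (j : ℝ) * φ + φ = 0 + (j + 1) * φ by ring]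
  refine ⟨a, ha0, fun n => ?_⟩
  have h1 := le_sum_vecAngle_ellipse hD hφ0 hφπ hecc 0 n
  have h2 : ∀ j ∈ Finset.range n, stepAngle A a j =
      vecAngle (ellipse a b (0 + j * φ)) (ellipse a b (0 + j * φ + φ)) := by
    intro j _
    rw [stepAngle, hpow, hpow, vecAngle_smul_smul (pow_ne_zero _ hr.ne') (pow_ne_zero _ hr.ne')]
    push_cast
    rw [show 0 + ((j : ℝ) + 1) * φ = 0 + j * φ + φ by ring]
  rw [Finset.sum_congr rfl h2]
  have h5 : rotationAngle l = min φ (Real.pi - φ) := rfl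
  rw [h5]
  linarith

/-! ### The angular values of a matrix -/

/-- Under the spectral condition and without opposite real eigenvalues, eigenvalues of equal modulus
are equal or conjugate, so they have equal `|arg|`. -/
lemma SpectralCondition.abs_arg_eq (hσ : SpectralCondition A)
    (hopp : ¬ ∃ t : ℝ, (t : ℂ) ∈ eigs A ∧ -(t : ℂ) ∈ eigs A) {l l' : ℂ} (hl : l ∈ eigs A)
    (hl' : l' ∈ eigs A) (h : ‖l‖ = ‖l'‖) : |l.arg| = |l'.arg| := by
  have key : ∀ l ∈ eigs A, ∀ l' ∈ eigs A, ‖l‖ = ‖l'‖ → l.im ≠ 0 → |l.arg| = |l'.arg| := by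
    intro l hl l' hl' h him
    by_contra hne
    refine (hσ l hl him).2 l' hl' ?_ ?_ h.symm
    · rintro rfl; exact hne rfl
    · rintro rfl
      refine hne ?_
      rw [Complex.arg_conj]
      split_ifs with hπ
      · rw [hπ]
      · rw [abs_neg]
  by_cases him : l.im = 0
  · by_cases him' : l'.im = 0
    · have e1 : l = (l.re : ℂ) := Complex.ext rfl (by simpa using him)
      have e2 : l' = (l'.re : ℂ) := Complex.ext rfl (by simpa using him')
      rw [e1, e2, Complex.norm_real, Complex.norm_real, Real.norm_eq_abs, Real.norm_eq_abs] at h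
      rcases abs_eq_abs.1 h with h1 | h1
      · rw [e1, e2, h1]
      · refine absurd ⟨l'.re, e2 ▸ hl', ?_⟩ hopp
        rw [← Complex.ofReal_neg, ← h1, ← e1]
        exact hl
    · exact (key l' hl' l hl h.symm him').symm
  · exact key l hl l' hl' h him

lemma rotationAngle_le_maxRotationAngle {l : ℂ} (hl : l ∈ eigs A) :
    rotationAngle l ≤ maxRotationAngle A := by
  refine le_csSup ⟨Real.pi, ?_⟩ ⟨l, hl, rfl⟩
  rintro _ ⟨m, -, rfl⟩
  exact (min_le_left _ _).trans (Complex.abs_arg_le_pi m)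

end Spectrum

end AngularValues

end

open AngularValues
theorem theorem5p6 (d : ℕ) (hd : 0 < d) (A : Matrix (Fin d) (Fin d) ℝ) (hA : IsUnit A)
    (hσ : SpectralCondition A) :
    -- all eight types of first angular values coincide
    (∀ τ τ' : AngularType, theta A τ = theta A τ') ∧
    -- they are the maximum of the values of the blocks
    (∀ (k : ℕ) (n : Fin k → ℕ) (Q : (i : Fin k) → Matrix (Fin d) (Fin (n i)) ℝ)
      (B : (i : Fin k) → Matrix (Fin (n i)) (Fin (n i)) ℝ), IsModulusDecomposition A Q B →
      ∀ τ : AngularType, IsGreatest (Set.range fun i => theta (B i) τ) (theta A τ)) ∧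
    -- a pair of real eigenvalues of opposite sign
    ((∃ t : ℝ, (t : ℂ) ∈ eigs A ∧ -(t : ℂ) ∈ eigs A) →
      ∀ τ : AngularType, theta A τ = Real.pi / 2) ∧
    -- no such pair
    ((¬ ∃ t : ℝ, (t : ℂ) ∈ eigs A ∧ -(t : ℂ) ∈ eigs A) →
      (∀ τ : AngularType, theta A τ ≤ maxRotationAngle A) ∧
      (maxRotationAngle A = 0 → ∀ τ : AngularType, theta A τ = maxRotationAngle A) ∧
      (∀ (k : ℕ) (n : Fin k → ℕ) (Q : (i : Fin k) → Matrix (Fin d) (Fin (n i)) ℝ)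
        (B : (i : Fin k) → Matrix (Fin (n i)) (Fin (n i)) ℝ), IsModulusDecomposition A Q B →
        ∀ (i₀ : Fin k) (l₀ : ℂ), l₀ ∈ eigs (B i₀) → l₀.im ≠ 0 →
          rotationAngle l₀ = maxRotationAngle A → skew (B i₀) ≤ 1 →
          ∀ τ : AngularType, theta A τ = rotationAngle l₀)) := by
  obtain ⟨Θ, hΘ, hub, happ⟩ := exists_common_value_of_isUnit hd hA
  refine ⟨fun τ τ' => (hΘ τ).trans (hΘ τ').symm,
    fun k n Q B h τ => h.isGreatest_theta hd hA τ, ?_, fun hopp => ?_⟩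
  · rintro ⟨t, h1, h2⟩ τ
    rw [hΘ τ]
    refine le_antisymm (le_of_average_le happ fun v hv ε hε => ⟨0, fun n => ?_⟩) ?_
    · have h3 : ∑ i ∈ Finset.range n, stepAngle A v i ≤ n * (Real.pi / 2) := by
        simpa using Finset.sum_le_card_nsmul (Finset.range n) (stepAngle A v) (Real.pi / 2)
          (fun _ _ => vecAngle_le_pi_div_two _ _)
      have h4 : 0 ≤ ε * n := by positivity
      linarith
    · obtain ⟨v, hv, hvj⟩ := exists_stepAngle_eq_pi_div_two hA h1 h2
      refine hub v hv _ 0 fun n => ?_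
      simp [hvj]
  · have hle : Θ ≤ maxRotationAngle A := by
      refine le_of_average_le happ fun v hv ε hε => ?_
      obtain ⟨l, hl, h⟩ := exists_sum_stepAngle_le hA
        (fun l hl l' hl' h => hσ.abs_arg_eq hopp hl hl' h) hv
      obtain ⟨C, hC⟩ := h ε hε
      refine ⟨C, fun n => (hC n).trans ?_⟩
      gcongr
      exact rotationAngle_le_maxRotationAngle hl
    refine ⟨fun τ => (hΘ τ).trans_le hle, fun h0 τ => ?_, ?_⟩
    · rw [hΘ τ, h0]
      rw [h0] at hle
      obtain ⟨v, hv, -⟩ := happ 1 one_pos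
      refine le_antisymm hle (hub v hv 0 0 fun n => ?_)
      simpa using Finset.sum_nonneg fun i _ => stepAngle_nonneg A v i
    · intro k n Q B h i₀ l₀ hl₀ him hmax hskew τ
      rw [hΘ τ]
      refine le_antisymm (hle.trans_eq hmax.symm) ?_
      obtain ⟨x, hx, hxn⟩ := exists_le_sum_stepAngle hl₀ him
        (fun m hm => h.equal_modulus i₀ m hm l₀ hl₀) hskew
      refine hub _ (toEuclideanLin_ne_zero (h.orthonormal i₀) hx) _ Real.pi fun n => ?_
      simp only [stepAngle_toEuclideanLin (h.orthonormal i₀) (h.intertwine i₀)]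
      exact hxn n
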